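/- Let $\mathcal E,\mathcal F$ be finite-dimensional Euclidean spaces with $\dim\mathcal F<\dim\mathcal E$ and duals $\mathcal E',\mathcal F'$. Let $J:\mathcal E\to[0,\infty)$ and $\psi:\mathcal E\to[0,\infty)$ be functions, $A:\mathcal E\to\mathcal F$ a linear operator with adjoint $A^*:\mathcal F'\to\mathcal E'$, $A^*q=q\circ A$, let $T>0$, and let $f\in W^{1,2}([0,T];\mathcal F)$ (identified with its absolutely continuous representative; $\dot f\in L^2$ denotes its a.e. derivative). **Notation.** For $S:\mathcal E\to[0,\infty)$ and $u\in\mathcal E$, the Fréchet subdifferential $\partial S(u)\subset\mathcal E'$ is the set of all $\xi\in\mathcal E'$ with $\liminf_{v\to u}\frac{S(v)-(S(u)+\langle\xi,v-u\rangle)}{|v-u|}\ge 0$. If $S$ has nonempty subdifferential at every point, then $u$ is called a critical point of $S$ on $\mathbf A(y):=\{v\in\mathcal E: Av=y\}$ when $Au=y$ and $\partial S(u)\cap\operatorname{ran}(A^*)\ne\emptyset$; stating that $u$ is a critical point of $S$ includes the nonemptiness of $\partial S$ at every point. $S$ is strongly convex if there is $\nu>0$ such that $\nu|v_1-v_2|^2\le\langle\xi_1-\xi_2,v_1-v_2\rangle$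 for all $v_1,v_2\in\mathcal E$, $\xi_1\in\partial S(v_1)$, $\xi_2\in\partial S(v_2)$. Set $K^*:=\partial\psi(0)$. For $u:[a,b]\to\mathcal E$, $$\mathrm{Var}_\psi(u;[a,b])=\sup\Big\{\sum_{i=1}^k\psi\big(u(t_i)-u(t_{i-1})\big):\ a=t_0<t_1<\dots<t_k=b,\ k\in\mathbb N\Big\}\in[0,\infty].$$ **Evolutions.** Given $v_0\in\mathcal E$ and $\delta>0$, a discrete quasistatic evolution with time step $\delta$, initial condition $v_0$ and constraint $f$ is a right-continuous function $v_\delta:[-\delta,T]\to\mathcal E$ such that $v_\delta=v_0$ on $[-\delta,\delta)\cap[-\delta,T]$ and, for every integer $i\ge0$ with $i\delta\le T$, $v_\delta$ is constant on $[0,T]\cap[i\delta,(i+1)\delta)$ and $v_\delta(i\delta)$ is a critical point of $v\mapsto J(v)+\psi(v-v_\delta((i-1)\delta))$ on $\mathbf A(f(i\delta))$. A bounded measurable $v:[0,T]\to\mathcal E$ is an approximable quasistatic evolution with initial condition $v_0$ and constraint $f$ if there are a sequence $\delta_k\to0^+$ and discrete quasistatic evolutions $v_{\delta_k}$ with time step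 $\delta_k$, initial condition $v_0$ and constraint $f$, such that $\liminf_{k\to\infty}|v_{\delta_k}(t)-v(t)|=0$ for every $t\in[0,T]$. **Theorem (existence of rate independent evolutions).** Assume: * ($\gamma$) there is $\gamma>0$ with $|A^*q|_{\mathcal E'}\ge\gamma|q|_{\mathcal F'}$ for all $q\in\mathcal F'$ (equivalently, $A$ is surjective); * (J1) $J(v)+|Av|^2\to+\infty$ as $|v|\to\infty$; * (J2) there is $\eta>0$ such that $v\mapsto J(v)+\eta|v|^2$ is strongly convex; * (J3) there is $L>0$ such that $|\xi|_{\mathcal E'}\le L(J(v)+1)$ for all $v\in\mathcal E$ and $\xi\in\partial J(v)$; * ($\Psi$1) $\psi(v)=0$ if and only if $v=0$; ($\Psi$2) $\psi(v_1+v_2)\le\psi(v_1)+\psi(v_2)$ for all $v_1,v_2$; ($\Psi$3) $\psi(\lambda v)=\lambda\psi(v)$ for all $\lambda\ge0$ and $v\in\mathcal E$; * $v_0\in\mathcal E$ is a critical point of $v\mapsto J(v)+\psi(v-v_0)$ on $\mathbf A(f(0))$. Then there exist $v\in BV([0,T];\mathcal E)$ (of bounded pointwise variation) and $q\in L^\infty([0,T];\mathcal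 F')$ such that: * (A) $v$ is an approximable quasistatic evolution with initial condition $v_0$ and constraint $f$; * (B) $A^*q(t)\in\partial J(v(t))+K^*$ for a.e. $t\in[0,T]$; * (C) the function $s\mapsto\langle q(s),\dot f(s)\rangle$ belongs to $L^1(0,T)$, and for all $0\le t_1<t_2\le T$ $$J(v(t_2))+\mathrm{Var}_\psi(v;[t_1,t_2])\le J(v(t_1))+\int_{t_1}^{t_2}\langle q(s),\dot f(s)\rangle\,ds.$$ -/

import Mathlib

open Set Filter Topology MeasureTheory
open scoped ENNReal Pointwise

namespace RateIndep

variable {E F : Type*}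
  [NormedAddCommGroup E] [InnerProductSpace ℝ E]
  [NormedAddCommGroup F] [InnerProductSpace ℝ F]

/-- The Fréchet subdifferential `∂S(u) ⊆ E'`:
`ξ ∈ ∂S(u)` iff `liminf_{v → u} (S v - (S u + ⟨ξ, v - u⟩)) / ‖v - u‖ ≥ 0`, which is written out
here as: for each `ε > 0` the quotient is `≥ -ε` for all `v` near `u`. -/
def frechetSubdiff (S : E → ℝ) (u : E) : Set (StrongDual ℝ E) :=
  {ξ | ∀ ε : ℝ, 0 < ε → ∀ᶠ v in 𝓝 u, S u + ξ (v - u) - ε * ‖v - u‖ ≤ S v}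

/-- The adjoint `A* : F' → E'`, `A* q = q ∘ A`. -/
def adj (A : E →L[ℝ] F) (q : StrongDual ℝ F) : StrongDual ℝ E := q ∘L A

/-- `u` is a critical point of `S` on the affine space `{v | A v = y}`; the notion presupposes
that `S` has nonempty subdifferential at every point. -/
def IsCriticalPoint (S : E → ℝ) (A : E →L[ℝ] F) (y : F) (u : E) : Prop :=
  (∀ w, (frechetSubdiff S w).Nonempty) ∧
    A u = y ∧ (frechetSubdiff S u ∩ range (adj A)).Nonempty

/-- Strong convexity, as strong monotonicity of the Fréchet subdifferential. -/
def StronglyConvex (S : E → ℝ) : Prop :=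
  ∃ ν : ℝ, 0 < ν ∧ ∀ v₁ v₂ : E, ∀ ξ₁ ∈ frechetSubdiff S v₁, ∀ ξ₂ ∈ frechetSubdiff S v₂,
    ν * ‖v₁ - v₂‖ ^ 2 ≤ (ξ₁ - ξ₂) (v₁ - v₂)

/-- The set `K* = ∂ψ(0)`. -/
def Kstar (ψ : E → ℝ) : Set (StrongDual ℝ E) := frechetSubdiff ψ 0

/-- The `ψ`-variation of `u` on `[a, b]`: the supremum, in the extended reals, of
`∑_{i=1}^k ψ (u (t_i) - u (t_{i-1}))` over all partitions `a = t_0 < t_1 < ⋯ < t_k = b`. -/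
noncomputable def psiVar (ψ : E → ℝ) (u : ℝ → E) (a b : ℝ) : EReal :=
  ⨆ (k : ℕ) (t : ℕ → ℝ) (_ : t 0 = a ∧ t k = b ∧ ∀ i < k, t i < t (i + 1)),
    ((∑ i ∈ Finset.range k, ψ (u (t (i + 1)) - u (t i)) : ℝ) : EReal)

/-- `f ∈ W^{1,2}([0,T]; F)`, for the continuous representative: `f` is absolutely continuous on
`[0,T]` and its (a.e. defined) derivative, which is its weak derivative, is in `L²`. -/
def MemW12 (f : ℝ → F) (T : ℝ) : Prop :=
  AbsolutelyContinuousOnInterval f 0 T ∧ MemLp (deriv f) 2 (volume.restrict (Icc 0 T))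

/-- `w : [-δ, T] → E` is a discrete quasistatic evolution with time step `δ`, initial condition
`v₀` and constraint `f`, for the energy `J` and the dissipation `ψ`. Functions on an interval
are given by functions on `ℝ`, of which only the values on that interval matter. -/
structure IsDiscreteEvolution (J ψ : E → ℝ) (A : E →L[ℝ] F) (f : ℝ → F) (T : ℝ) (v₀ : E)
    (δ : ℝ) (w : ℝ → E) : Prop where
  step_pos : 0 < δ
  right_continuous : ∀ t ∈ Icc (-δ) T, ContinuousWithinAt w (Icc t T) t
  initial : ∀ t ∈ Icc (-δ) T ∩ Ico (-δ) δ, w t = v₀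
  piecewise_const : ∀ i : ℕ, i * δ ≤ T →
    ∀ t ∈ Icc 0 T ∩ Ico (i * δ) ((i + 1) * δ), w t = w (i * δ)
  critical : ∀ i : ℕ, i * δ ≤ T →
    IsCriticalPoint (fun v => J v + ψ (v - w (((i : ℝ) - 1) * δ))) A (f (i * δ)) (w (i * δ))

/-- `v : [0, T] → E` is an approximable quasistatic evolution with initial condition `v₀` and
constraint `f`: it is bounded and measurable, and one sequence of discrete evolutions, with time
steps tending to `0⁺`, satisfies `liminf_k ‖v_k(t) - v(t)‖ = 0` (a `liminf` in `[0, ∞]`) at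
every `t ∈ [0, T]`. -/
def IsApproximableEvolution [MeasurableSpace E] (J ψ : E → ℝ) (A : E →L[ℝ] F) (f : ℝ → F)
    (T : ℝ) (v₀ : E) (v : ℝ → E) : Prop :=
  Bornology.IsBounded (v '' Icc 0 T) ∧
  Measurable (fun t : Icc (0 : ℝ) T => v t) ∧
  ∃ (δ : ℕ → ℝ) (w : ℕ → ℝ → E), Tendsto δ atTop (𝓝[>] 0) ∧
    (∀ k, IsDiscreteEvolution J ψ A f T v₀ (δ k) (w k)) ∧
    ∀ t ∈ Icc 0 T, liminf (fun k => ‖w k t - v t‖ₑ) atTop = 0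

end RateIndep

open RateIndep

/-! The evolution is a limit of incremental minimization: from `x`, the next state `x'` minimizes `J
+ ψ(· - x)` on the fibre of `A` over the new datum. As `J` is only semiconvex, testing the
multiplier of `x'` at `x` would leave a quadratic error in the energy balance. So each step
(`IsAdmissible.exists_isStep`) also takes the proximal minimizer `u` of the same functional plus `(η
+ 1)‖· - x‖²`. This functional is convex, so its multiplier `q` may be tested at `x`; since `x'`
does at least as well as `u`, the step obeys `J x' + ψ(x' - x) ≤ J x + q(Δf)`.

The bounds (γ) and (J3) control `q` by the energy, and a discrete Gronwall argument makes all
estimates uniform in the time step (`IsAdmissible.exists_discrete`). Comparison with the stability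
of `x` gives `‖u - x‖² ≤ M ‖Δf‖`, so the auxiliary states have the same limit as the evolution
itself.

Helly's principle (`exists_subseq_tendsto_of_monotone_control`) gives pointwise convergence of the
states, and weak compactness in `L²` (`exists_weak_limit`) a limit of the multipliers. The stability
inequality is affine in the multiplier, so it survives the weak limit
(`IsApproximation.ae_isStableMultiplier`); so does the energy inequality, partition by partition
(`IsApproximation.energy_add_sum_le`). Stability of the limit then yields (B) and the `L^∞` bound on
`q`. -/

namespace RateIndep

variable {E F : Type*} [NormedAddCommGroup E] [InnerProductSpace ℝ E]
  [NormedAddCommGroup F] [InnerProductSpace ℝ F]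

/-! ### Convexity from monotonicity of the Fréchet subdifferential -/

section Convexity

/-- A function with a Fréchet subgradient at `u` is lower semicontinuous at `u`. -/
lemma lowerSemicontinuousAt_of_mem_frechetSubdiff {S : E → ℝ} {u : E} {ξ : StrongDual ℝ E}
    (h : ξ ∈ frechetSubdiff S u) : LowerSemicontinuousAt S u := by
  intro y hy
  have hc : Tendsto (fun v => S u + ξ (v - u) - 1 * ‖v - u‖) (𝓝 u) (𝓝 (S u)) := by
    have : Continuous (fun v => S u + ξ (v - u) - 1 * ‖v - u‖) := by fun_prop
    simpa using this.tendsto u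
  filter_upwards [h 1 one_pos, hc.eventually (lt_mem_nhds hy)] with v h1 h2
  exact h2.trans_le h1

lemma mem_frechetSubdiff_of_forall {S : E → ℝ} {u : E} {ξ : StrongDual ℝ E} {c : ℝ}
    (h : ∀ v, S u + ξ (v - u) - c * ‖v - u‖ ^ 2 ≤ S v) : ξ ∈ frechetSubdiff S u := by
  intro ε hε
  have hc' : Tendsto (fun v => c * ‖v - u‖) (𝓝 u) (𝓝 0) := by
    have : Continuous (fun v => c * ‖v - u‖) := by fun_prop
    simpa using this.tendsto u
  filter_upwards [hc'.eventually (gt_mem_nhds hε)] with v hv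
  refine le_trans ?_ (h v)
  nlinarith [norm_nonneg (v - u)]

lemma exists_isMinOn_add_sq [FiniteDimensional ℝ E] {H : E → ℝ} (hH : LowerSemicontinuous H)
    (h0 : ∀ v, 0 ≤ H v) {r : ℝ} (hr : 0 < r) (x : E) :
    ∃ y, ∀ z, H y + r * ‖x - y‖ ^ 2 ≤ H z + r * ‖x - z‖ ^ 2 := by
  have hlsc : LowerSemicontinuous (fun z => H z + r * ‖x - z‖ ^ 2) :=
    hH.add (Continuous.lowerSemicontinuous (by fun_prop))
  -- Outside the ball of this radius the penalty alone is at least `r * ρ = H x + r`, more than the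
  -- value `H x` at `x`.
  set ρ : ℝ := H x / r + 1
  have hρ : 1 ≤ ρ := by have := div_nonneg (h0 x) hr.le; linarith
  obtain ⟨y, hy, hmin⟩ := (hlsc.lowerSemicontinuousOn (Metric.closedBall x ρ)).exists_isMinOn
    ⟨x, Metric.mem_closedBall_self (by linarith)⟩ (isCompact_closedBall x ρ)
  refine ⟨y, fun z => ?_⟩
  by_cases hz : z ∈ Metric.closedBall x ρ
  · exact hmin hz
  · have h1 := hmin (Metric.mem_closedBall_self (x := x) (ε := ρ) (by linarith))
    simp only [sub_self, norm_zero, mem_ofPred_eq] at h1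
    rw [Metric.mem_closedBall, not_le, dist_comm, dist_eq_norm] at hz
    have h2 : r * ρ = H x + r := by simp only [ρ]; field_simp
    have h3 : ρ ≤ ‖x - z‖ ^ 2 := by nlinarith
    have h4 := mul_le_mul_of_nonneg_left h3 hr.le
    have h5 := h0 z
    linarith

open scoped RealInnerProductSpace in
/-- A finite, nonnegative, lower semicontinuous function on a finite-dimensional space with
monotone Fréchet subdifferential is convex. -/
lemma convexOn_of_monotone_frechetSubdiff [FiniteDimensional ℝ E] {H : E → ℝ}
    (hH : LowerSemicontinuous H) (h0 : ∀ v, 0 ≤ H v)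
    (hmono : ∀ v₁ v₂ : E, ∀ ξ₁ ∈ frechetSubdiff H v₁, ∀ ξ₂ ∈ frechetSubdiff H v₂,
      0 ≤ (ξ₁ - ξ₂) (v₁ - v₂)) :
    ConvexOn ℝ univ H := by
  -- the Moreau envelope `M` of `H` has a supporting affine function at every point
  have key : ∀ r : ℝ, 0 < r → ∃ P : E → E, (∀ x z, H (P x) + r * ‖x - P x‖ ^ 2 ≤
      H z + r * ‖x - z‖ ^ 2) ∧ ∀ x x', H (P x) + r * ‖x - P x‖ ^ 2 + 2 * r * ⟪x - P x, x' - x⟫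
        ≤ H (P x') + r * ‖x' - P x'‖ ^ 2 := by
    intro r hr
    choose P hP using exists_isMinOn_add_sq hH h0 hr
    refine ⟨P, hP, ?_⟩
    have hsub : ∀ x, (2 * r) • innerSL ℝ (x - P x) ∈ frechetSubdiff H (P x) := by
      intro x
      refine mem_frechetSubdiff_of_forall (c := r) fun v => ?_
      have h1 := hP x v
      have h2 : x - v = (x - P x) - (v - P x) := by abel
      rw [h2, norm_sub_sq_real (x - P x)] at h1
      simp only [smul_apply, innerSL_apply_apply, smul_eq_mul]
      linarith
    -- The residual `x - P x` is half the gradient of the envelope divided by `r`; its monotonicity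
    -- is inherited from the subgradients `2r (x - P x)` of `H` at `P x`.
    have hmon : ∀ x x', 0 ≤ ⟪(x' - P x') - (x - P x), x' - x⟫ := by
      intro x x'
      have h1 := hmono _ _ _ (hsub x') _ (hsub x)
      simp only [sub_apply, smul_apply,
        innerSL_apply_apply, smul_eq_mul] at h1
      have h2 : 0 ≤ ⟪(x' - P x') - (x - P x), P x' - P x⟫ := by
        rw [inner_sub_left]; nlinarith
      have h3 : x' - x = ((x' - P x') - (x - P x)) + (P x' - P x) := by abel
      rw [h3, inner_add_right, real_inner_self_eq_norm_sq]
      positivity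
    -- With `P x'` as competitor for `x`, the affine bound uses the slope at the far end `x'` and
    -- misses by a quadratic term.
    have hstep : ∀ x x', H (P x) + r * ‖x - P x‖ ^ 2 + 2 * r * ⟪x' - P x', x' - x⟫
        - r * ‖x' - x‖ ^ 2 ≤ H (P x') + r * ‖x' - P x'‖ ^ 2 := by
      intro x x'
      have h1 := hP x (P x')
      have h2 : x - P x' = (x' - P x') - (x' - x) := by abel
      rw [h2, norm_sub_sq_real (x' - P x')] at h1
      linarith
    -- Along equal steps `h`, monotonicity replaces each slope by the one at `x`. With `h` the
    -- `n`-th part of `x' - x`, the quadratic errors add up to `r ‖x' - x‖² / n`, which vanishes.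
    have htel : ∀ x h : E, ∀ n : ℕ, H (P x) + r * ‖x - P x‖ ^ 2
        + n * (2 * r * ⟪x - P x, h⟫) - n * (r * ‖h‖ ^ 2) ≤
        H (P (x + n • h)) + r * ‖(x + n • h) - P (x + n • h)‖ ^ 2 := by
      intro x h n
      induction n with
      | zero => simp
      | succ n ih =>
        have h1 := hstep (x + n • h) (x + (n + 1) • h)
        have h2 : (x + (n + 1) • h) - (x + n • h) = h := by rw [add_smul]; simp
        rw [h2] at h1
        have h3 := hmon x (x + (n + 1) • h)
        have h4 : (x + (n + 1) • h) - x = ((n : ℝ) + 1) • h := by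
          rw [add_sub_cancel_left, ← Nat.cast_smul_eq_nsmul ℝ]; push_cast; rfl
        rw [h4, inner_smul_right, inner_sub_left] at h3
        have h5 := nonneg_of_mul_nonneg_right h3 (by positivity)
        push_cast
        nlinarith
    intro x x'
    have hlim : ∀ n : ℕ, H (P x) + r * ‖x - P x‖ ^ 2 + 2 * r * ⟪x - P x, x' - x⟫
        - (r * ‖x' - x‖ ^ 2) * (1 / ((n : ℝ) + 1)) ≤ H (P x') + r * ‖x' - P x'‖ ^ 2 := by
      intro n
      have hn : ((n : ℝ) + 1) ≠ 0 := by positivity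
      have h1 := htel x (((n : ℝ) + 1)⁻¹ • (x' - x)) (n + 1)
      have h2 : x + (n + 1) • (((n : ℝ) + 1)⁻¹ • (x' - x)) = x' := by
        rw [← Nat.cast_smul_eq_nsmul ℝ]; push_cast
        rw [smul_inv_smul₀ hn]; abel
      rw [h2, inner_smul_right, norm_smul, Real.norm_of_nonneg (by positivity)] at h1
      push_cast at h1
      refine le_trans (le_of_eq ?_) h1
      field_simp
    have ht : Tendsto (fun n : ℕ => H (P x) + r * ‖x - P x‖ ^ 2 + 2 * r * ⟪x - P x, x' - x⟫
        - (r * ‖x' - x‖ ^ 2) * (1 / ((n : ℝ) + 1))) atTop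
        (𝓝 (H (P x) + r * ‖x - P x‖ ^ 2 + 2 * r * ⟪x - P x, x' - x⟫
        - (r * ‖x' - x‖ ^ 2) * 0)) :=
      tendsto_const_nhds.sub (tendsto_one_div_add_atTop_nhds_zero_nat.const_mul _)
    have := le_of_tendsto' ht hlim
    simpa using this
  refine ⟨convex_univ, fun x _ y _ a b ha hb hab => ?_⟩
  set z := a • x + b • y
  simp only [smul_eq_mul]
  refine le_of_forall_lt fun c hc => ?_
  -- choose `r` so large that the proximal point is close to `z`
  obtain ⟨ε, hε, hball⟩ := Metric.eventually_nhds_iff.1 (hH z c hc)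
  -- Since `r ‖z - P z‖² ≤ H z < r ε²`, this puts `P z` in the `ε`-ball where lower semicontinuity
  -- gives `c < H (P z)`.
  set r := (H z + 1) / ε ^ 2
  have hr : 0 < r := by have := h0 z; positivity
  obtain ⟨P, hP, hM⟩ := key r hr
  have hle : ∀ x, H (P x) + r * ‖x - P x‖ ^ 2 ≤ H x := fun x => by simpa using hP x x
  have hPz : dist (P z) z < ε := by
    rw [dist_comm, dist_eq_norm]
    have h1 := hle z
    have h2 := h0 (P z)
    have h3 : r * ε ^ 2 = H z + 1 := by simp only [r]; field_simp
    have h4 : r * ‖z - P z‖ ^ 2 < r * ε ^ 2 := by linarith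
    exact lt_of_pow_lt_pow_left₀ 2 hε.le (lt_of_mul_lt_mul_left h4 hr.le)
  have h1 := hball hPz
  have h2 := (hM z x).trans (hle x)
  have h3 := (hM z y).trans (hle y)
  have h4 : a * ⟪z - P z, x - z⟫ + b * ⟪z - P z, y - z⟫ = 0 := by
    rw [← inner_smul_right, ← inner_smul_right, ← inner_add_right]
    have : a • (x - z) + b • (y - z) = 0 := by
      have : a • (x - z) + b • (y - z) = z - (a + b) • z := by simp only [z]; module
      rw [this, hab, one_smul, sub_self]
    rw [this, inner_zero_right]
  have h5 : 0 ≤ r * ‖z - P z‖ ^ 2 := by positivity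
  have h6 := mul_le_mul_of_nonneg_left h2 ha
  have h7 := mul_le_mul_of_nonneg_left h3 hb
  have hb' : b = 1 - a := by linarith
  subst hb'
  nlinarith

/-- Subadditive and positively homogeneous functions. -/
structure IsSublinear (ψ : E → ℝ) : Prop where
  add_le : ∀ v₁ v₂, ψ (v₁ + v₂) ≤ ψ v₁ + ψ v₂
  smul_eq : ∀ c : ℝ, 0 ≤ c → ∀ v, ψ (c • v) = c * ψ v

/-- `J` is convex up to the quadratic perturbation `η ‖·‖²`. -/
def SemiconvexWith (η : ℝ) (J : E → ℝ) : Prop :=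
  ConvexOn ℝ univ (fun v => J v + η * ‖v‖ ^ 2)

lemma IsSublinear.convexOn {ψ : E → ℝ} (hψ : IsSublinear ψ) : ConvexOn ℝ univ ψ := by
  refine ⟨convex_univ, fun x _ y _ a b ha hb _ => ?_⟩
  refine (hψ.add_le _ _).trans ?_
  rw [hψ.smul_eq a ha, hψ.smul_eq b hb]; rfl

lemma IsSublinear.map_zero {ψ : E → ℝ} (hψ : IsSublinear ψ) : ψ 0 = 0 := by
  simpa using hψ.smul_eq 0 le_rfl 0

lemma _root_.ConvexOn.continuous_univ [FiniteDimensional ℝ E] {H : E → ℝ}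
    (h : ConvexOn ℝ univ H) : Continuous H := h.locallyLipschitz.continuous

/-- No regularity of `J` is assumed; lower semicontinuity comes from the nonempty subdifferentials
built into the criticality of `v₀`, after subtracting the continuous `ψ(· - v₀)`. -/
lemma semiconvexWith_of_stronglyConvex [FiniteDimensional ℝ E] {J ψ : E → ℝ} {η : ℝ} {v₀ : E}
    (hη : 0 < η) (hJ_nonneg : ∀ v, 0 ≤ J v) (hψc : Continuous ψ)
    (hJ2 : StronglyConvex (fun v => J v + η * ‖v‖ ^ 2))
    (hne : ∀ w, (frechetSubdiff (fun v => J v + ψ (v - v₀)) w).Nonempty) :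
    SemiconvexWith η J := by
  have hlsc : LowerSemicontinuous J := by
    have h1 : LowerSemicontinuous (fun v => J v + ψ (v - v₀)) := fun w =>
      lowerSemicontinuousAt_of_mem_frechetSubdiff (hne w).some_mem
    have h2 : LowerSemicontinuous (fun v => -ψ (v - v₀)) :=
      Continuous.lowerSemicontinuous (by fun_prop)
    have h3 : J = fun v => (J v + ψ (v - v₀)) + -ψ (v - v₀) := by funext v; ring
    rw [h3]
    exact h1.add h2
  obtain ⟨ν, hν, hmono⟩ := hJ2
  refine convexOn_of_monotone_frechetSubdiff
    (hlsc.add (Continuous.lowerSemicontinuous (by fun_prop)))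
    (fun v => by have := hJ_nonneg v; positivity) fun v₁ v₂ ξ₁ h₁ ξ₂ h₂ => ?_
  exact le_trans (by positivity) (hmono v₁ v₂ ξ₁ h₁ ξ₂ h₂)

end Convexity

/-! ### Semiconvex calculus: global subgradients, multipliers, sum rule -/

section Subdifferentials

lemma IsSublinear.continuous [FiniteDimensional ℝ E] {ψ : E → ℝ} (hψ : IsSublinear ψ) :
    Continuous ψ := hψ.convexOn.continuous_univ

open scoped RealInnerProductSpace in
lemma norm_sq_convex_combination (x y : E) {a b : ℝ} (hab : a + b = 1) :
    ‖a • x + b • y‖ ^ 2 = a * ‖x‖ ^ 2 + b * ‖y‖ ^ 2 - a * b * ‖x - y‖ ^ 2 := by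
  rw [norm_add_sq_real, norm_sub_sq_real, norm_smul, norm_smul, inner_smul_left, inner_smul_right,
    mul_pow, mul_pow, Real.norm_eq_abs, Real.norm_eq_abs, sq_abs, sq_abs]
  obtain rfl : b = 1 - a := by linarith
  simp only [conj_trivial]
  ring

lemma SemiconvexWith.le {J : E → ℝ} {η : ℝ} (hJ : SemiconvexWith η J) (x y : E) {a b : ℝ}
    (ha : 0 ≤ a) (hb : 0 ≤ b) (hab : a + b = 1) :
    J (a • x + b • y) ≤ a * J x + b * J y + η * (a * b) * ‖x - y‖ ^ 2 := by
  have h := hJ.2 (mem_univ x) (mem_univ y) ha hb hab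
  simp only [smul_eq_mul, norm_sq_convex_combination x y hab] at h
  linarith

lemma semiconvexWith_iff {J : E → ℝ} {η : ℝ} : SemiconvexWith η J ↔ ∀ (x y : E) (a b : ℝ),
    0 ≤ a → 0 ≤ b → a + b = 1 →
    J (a • x + b • y) ≤ a * J x + b * J y + η * (a * b) * ‖x - y‖ ^ 2 := by
  refine ⟨fun h x y a b => h.le x y, fun h => ⟨convex_univ, fun x _ y _ a b ha hb hab => ?_⟩⟩
  have := h x y a b ha hb hab
  simp only [smul_eq_mul, norm_sq_convex_combination x y hab]
  linarith

lemma SemiconvexWith.add_convexOn {J φ : E → ℝ} {η : ℝ} (hJ : SemiconvexWith η J)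
    (hφ : ConvexOn ℝ univ φ) : SemiconvexWith η (fun v => J v + φ v) := by
  refine semiconvexWith_iff.2 fun x y a b ha hb hab => ?_
  have h1 := hJ.le x y ha hb hab
  have h2 := hφ.2 (mem_univ x) (mem_univ y) ha hb hab
  simp only [smul_eq_mul] at h2
  linarith

/-- The defect in the convexity inequality depends only on `x - y`, so the quadratic may be centred
anywhere. -/
lemma SemiconvexWith.convexOn_add_sq {J : E → ℝ} {η c : ℝ} (hJ : SemiconvexWith η J)
    (hc : η ≤ c) (x₀ : E) : ConvexOn ℝ univ (fun v => J v + c * ‖v - x₀‖ ^ 2) := by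
  refine ⟨convex_univ, fun x _ y _ a b ha hb hab => ?_⟩
  have h1 := hJ.le x y ha hb hab
  have h2 : a • x + b • y - x₀ = a • (x - x₀) + b • (y - x₀) := by
    have h3 : a • (x - x₀) + b • (y - x₀) = a • x + b • y - (a + b) • x₀ := by module
    rw [h3, hab, one_smul]
  have h3 : x - x₀ - (y - x₀) = x - y := by abel
  simp only [smul_eq_mul]
  rw [h2, norm_sq_convex_combination _ _ hab, h3]
  have h4 : 0 ≤ (c - η) * (a * b * ‖x - y‖ ^ 2) :=
    mul_nonneg (by linarith) (by positivity)
  linarith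

lemma convexOn_translate {φ : E → ℝ} (hφ : ConvexOn ℝ univ φ) (w : E) :
    ConvexOn ℝ univ (fun v => φ (v - w)) := by
  have := hφ.translate_left (-w)
  simpa [Function.comp_def, sub_eq_add_neg] using this

lemma SemiconvexWith.continuous [FiniteDimensional ℝ E] {J : E → ℝ} {η : ℝ}
    (hJ : SemiconvexWith η J) : Continuous J := by
  have h := (hJ.convexOn_add_sq le_rfl 0).continuous_univ
  have h2 : J = fun v => (J v + η * ‖v - 0‖ ^ 2) - η * ‖v - 0‖ ^ 2 := by funext v; ring
  rw [h2]
  fun_prop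

/-- Fréchet subgradients of semiconvex functions are global subgradients up to a quadratic. -/
lemma SemiconvexWith.mem_frechetSubdiff_iff {J : E → ℝ} {η : ℝ} (hJ : SemiconvexWith η J)
    (hη : 0 ≤ η) {u : E} {ξ : StrongDual ℝ E} :
    ξ ∈ frechetSubdiff J u ↔ ∀ v, J u + ξ (v - u) - η * ‖v - u‖ ^ 2 ≤ J v := by
  refine ⟨fun h v => ?_, mem_frechetSubdiff_of_forall⟩
  refine le_of_forall_pos_le_add fun ε hε => ?_
  -- The local inequality is used at a point of the segment close to `u` and carried to `v` by
  -- semiconvexity.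
  have hcont : Tendsto (fun t : ℝ => u + t • (v - u)) (𝓝[>] 0) (𝓝 u) := by
    have : Continuous (fun t : ℝ => u + t • (v - u)) := by fun_prop
    simpa using (this.tendsto 0).mono_left nhdsWithin_le_nhds
  have hε' : 0 < ε / (‖v - u‖ + 1) := by positivity
  have hevent := (hcont.eventually (h _ hε')).and (Ioc_mem_nhdsGT (one_pos : (0 : ℝ) < 1))
  obtain ⟨t, ht, ht0, ht1⟩ := hevent.exists
  have h1 := hJ.le u v (a := 1 - t) (b := t) (by linarith) ht0.le (by ring)
  have h2 : (1 - t) • u + t • v = u + t • (v - u) := by module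
  rw [h2] at h1
  have h3 := ht.trans h1
  rw [add_sub_cancel_left, map_smul, norm_smul, Real.norm_of_nonneg ht0.le, norm_sub_rev u v,
    smul_eq_mul] at h3
  have h4 : ε / (‖v - u‖ + 1) * ‖v - u‖ ≤ ε := by
    rw [div_mul_eq_mul_div, div_le_iff₀ (by positivity)]
    nlinarith [norm_nonneg (v - u)]
  have h5 : t * (J u + ξ (v - u) - ε / (‖v - u‖ + 1) * ‖v - u‖) ≤
      t * (J v + η * (1 - t) * ‖v - u‖ ^ 2) := by linarith
  have h6 := le_of_mul_le_mul_left h5 ht0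
  have h7 : 0 ≤ η * t * ‖v - u‖ ^ 2 := by positivity
  linarith

/-- Lagrange multipliers for a continuous convex function minimized on `u + V`. -/
lemma _root_.ConvexOn.exists_multiplier {X : Type*} [NormedAddCommGroup X] [NormedSpace ℝ X]
    {Φ : X → ℝ} (hΦ : ConvexOn ℝ univ Φ) (hc : Continuous Φ) (V : Submodule ℝ X) (u : X)
    (hmin : ∀ h ∈ V, Φ u ≤ Φ (u + h)) :
    ∃ ξ : StrongDual ℝ X, (∀ h ∈ V, ξ h = 0) ∧ ∀ v, Φ u + ξ (v - u) ≤ Φ v := by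
  -- The open strict epigraph is separated from the affine set `(u + V) × {Φ u}`; the slope of the
  -- separating hyperplane is the multiplier.
  have hs : Convex ℝ {p : X × ℝ | Φ p.1 < p.2} := by
    simpa using hΦ.convex_strict_epigraph
  have hso : IsOpen {p : X × ℝ | Φ p.1 < p.2} := isOpen_lt (by fun_prop) (by fun_prop)
  have ht : Convex ℝ {p : X × ℝ | p.1 - u ∈ V ∧ p.2 = Φ u} := by
    rintro ⟨x, s⟩ ⟨hx, hs⟩ ⟨y, t⟩ ⟨hy, ht⟩ a b ha hb hab
    simp only at hx hs hy ht
    subst hs ht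
    refine ⟨?_, ?_⟩
    · have h3 : a • x + b • y - u = a • (x - u) + b • (y - u) := by
        have h3 : a • (x - u) + b • (y - u) = a • x + b • y - (a + b) • u := by module
        rw [h3, hab, one_smul]
      simp only [Prod.fst_add, Prod.smul_fst, h3]
      exact V.add_mem (V.smul_mem _ hx) (V.smul_mem _ hy)
    · simp only [Prod.snd_add, Prod.smul_snd, ← add_smul, hab, one_smul]
  have hdisj : Disjoint {p : X × ℝ | Φ p.1 < p.2} {p : X × ℝ | p.1 - u ∈ V ∧ p.2 = Φ u} := by
    rw [Set.disjoint_left]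
    rintro ⟨x, s⟩ (h1 : Φ x < s) ⟨h2, h3⟩
    have := hmin _ h2
    simp only [add_sub_cancel] at this h3
    linarith
  obtain ⟨f, c, hf1, hf2⟩ := geometric_hahn_banach_open hs hso ht hdisj
  set g : StrongDual ℝ X := f ∘L ContinuousLinearMap.inl ℝ X ℝ
  set β : ℝ := f (0, 1)
  have hfg : ∀ x s, f (x, s) = g x + s * β := by
    intro x s
    have : ((x, s) : X × ℝ) = (x, 0) + s • (0, 1) := by simp
    rw [this, map_add, map_smul]; rfl
  have h1 : ∀ x s, Φ x < s → g x + s * β < c := fun x s h => by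
    rw [← hfg]; exact hf1 (x, s) h
  have h2 : ∀ h ∈ V, c ≤ g u + g h + Φ u * β := fun h hh => by
    rw [← map_add, ← hfg]; exact hf2 (u + h, Φ u) ⟨by simpa using hh, rfl⟩
  have hβ : β < 0 := by
    have h3 := h1 u (Φ u + 1) (by linarith)
    have h4 := h2 0 V.zero_mem
    rw [map_zero] at h4
    linarith
  refine ⟨(-β)⁻¹ • g, fun h hh => ?_, fun v => ?_⟩
  · have hg : g h = 0 := by
      -- A linear functional bounded below on a subspace vanishes there; the multiple of `h` below
      -- would force `c ≤ c - 1`.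
      by_contra hne
      have h3 := h2 (((c - 1 - g u - Φ u * β) / g h) • h) (V.smul_mem _ hh)
      rw [map_smul, smul_eq_mul, div_mul_cancel₀ _ hne] at h3
      linarith
    simp [hg]
  · have h4 := h2 0 V.zero_mem
    rw [map_zero] at h4
    have h5 : g v + Φ v * β ≤ g u + Φ u * β := by
      refine le_of_forall_pos_le_add fun ε hε => ?_
      have h6 := h1 v (Φ v + ε / (-β)) (by have := div_pos hε (neg_pos.2 hβ); linarith)
      have h7 : ε / (-β) * β = -ε := by rw [div_neg, neg_mul, div_mul_cancel₀ _ hβ.ne]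
      rw [add_mul, h7] at h6
      linarith
    have h6 : (-β)⁻¹ * (g v - g u) ≤ Φ v - Φ u := by
      rw [inv_mul_le_iff₀ (neg_pos.2 hβ)]; linarith
    simp only [smul_apply, smul_eq_mul, map_sub]
    linarith

/-- A proper range would be annihilated by some nonzero `q`, and then `adj A q = 0`. -/
lemma surjective_of_adj_lower_bound [FiniteDimensional ℝ F] {A : E →L[ℝ] F} {γ : ℝ} (hγ : 0 < γ)
    (h : ∀ q : StrongDual ℝ F, γ * ‖q‖ ≤ ‖adj A q‖) : Function.Surjective A := by
  rw [← ContinuousLinearMap.coe_coe, ← LinearMap.range_eq_top]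
  by_contra hne
  obtain ⟨q, hq, hle⟩ := Submodule.exists_le_ker_of_lt_top _ (lt_top_iff_ne_top.2 hne)
  have h1 := h (LinearMap.toContinuousLinearMap q)
  have h2 : adj A (LinearMap.toContinuousLinearMap q) = 0 := by
    ext v
    exact hle ⟨v, rfl⟩
  rw [h2, norm_zero] at h1
  have h3 : ‖LinearMap.toContinuousLinearMap q‖ ≤ 0 := nonpos_of_mul_nonpos_right h1 hγ
  rw [norm_le_zero_iff] at h3
  exact hq ((LinearEquiv.map_eq_zero_iff LinearMap.toContinuousLinearMap).1 h3)

/-- Lagrange multipliers for semiconvex functions minimized on an affine fibre of `A`. -/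
lemma SemiconvexWith.exists_multiplier [FiniteDimensional ℝ E] [FiniteDimensional ℝ F]
    {S : E → ℝ} {η : ℝ} (hS : SemiconvexWith η S) {A : E →L[ℝ] F} (hA : Function.Surjective A)
    (hη : 0 ≤ η) {u : E} (hmin : ∀ v, A v = A u → S u ≤ S v) :
    ∃ q : StrongDual ℝ F, adj A q ∈ frechetSubdiff S u := by
  have hconv := hS.convexOn_add_sq le_rfl u
  obtain ⟨ξ, h1, h2⟩ := hconv.exists_multiplier hconv.continuous_univ A.ker u fun h hh => by
    have hh' : A h = 0 := hh
    have h1 := hmin (u + h) (by rw [map_add, hh', add_zero])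
    have h2 : 0 ≤ η * ‖u + h - u‖ ^ 2 := by positivity
    simp only [sub_self, norm_zero]
    linarith
  -- The subgradient `ξ` vanishes on the kernel of `A`, so it factors through `A` by means of a
  -- right inverse.
  obtain ⟨B, hB⟩ := A.exists_rightInverse_of_surjective (LinearMap.range_eq_top.2 hA)
  refine ⟨ξ ∘L B, ?_⟩
  have h3 : adj A (ξ ∘L B) = ξ := by
    ext v
    have h4 : A (B (A v)) = A v := DFunLike.congr_fun hB (A v)
    have h5 := h1 (v - B (A v)) (by
      change A (v - B (A v)) = 0
      rw [map_sub, h4, sub_self])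
    rw [map_sub] at h5
    change ξ (B (A v)) = ξ v
    linarith
  rw [h3]
  refine mem_frechetSubdiff_of_forall (c := η) fun v => ?_
  have := h2 v
  simp only [sub_self, norm_zero] at this
  linarith

lemma IsSublinear.mem_Kstar_iff {ψ : E → ℝ} (hψ : IsSublinear ψ) {ζ : StrongDual ℝ E} :
    ζ ∈ Kstar ψ ↔ ∀ v, ζ v ≤ ψ v := by
  have h : SemiconvexWith 0 ψ := by simpa [SemiconvexWith] using hψ.convexOn
  simp [Kstar, h.mem_frechetSubdiff_iff le_rfl, hψ.map_zero]

/-- Sum rule for a semiconvex function and a translated sublinear function. -/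
lemma SemiconvexWith.exists_add_of_mem_frechetSubdiff_add [FiniteDimensional ℝ E] {J ψ : E → ℝ}
    {η : ℝ} (hJ : SemiconvexWith η J) (hη : 0 ≤ η) (hψ : IsSublinear ψ) {w u : E} {l : StrongDual ℝ E}
    (hl : l ∈ frechetSubdiff (fun v => J v + ψ (v - w)) u) :
    ∃ ξ ∈ frechetSubdiff J u, ∃ ζ ∈ Kstar ψ, ξ + ζ = l := by
  have hl' := ((hJ.add_convexOn (convexOn_translate hψ.convexOn w)).mem_frechetSubdiff_iff hη).1 hl
  have h1 := hJ.convexOn_add_sq le_rfl u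
  -- Doubling of variables: this separable function is minimal at `(u, u)` along the diagonal. Its
  -- multiplier vanishes on the diagonal, so its two components are opposite and give the two
  -- summands.
  have hΦ : ConvexOn ℝ univ (fun p : E × E =>
      (J p.1 + η * ‖p.1 - u‖ ^ 2) + ψ (p.2 - w) + (-l) p.1) := by
    have ha := h1.comp_linearMap (LinearMap.fst ℝ E E)
    have hb := (convexOn_translate hψ.convexOn w).comp_linearMap (LinearMap.snd ℝ E E)
    have hc := ((-l).toLinearMap ∘ₗ LinearMap.fst ℝ E E).convexOn (convex_univ (𝕜 := ℝ))
    exact (ha.add hb).add hc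
  obtain ⟨ξ, hV, hξ⟩ := hΦ.exists_multiplier hΦ.locallyLipschitz.continuous
    (LinearMap.eqLocus (LinearMap.fst ℝ E E) (LinearMap.snd ℝ E E)) (u, u) (by
      rintro ⟨h, h'⟩ hh
      obtain rfl : h = h' := hh
      have := hl' (u + h)
      simp only [add_sub_cancel_left] at this
      simp only [Prod.mk_add_mk, sub_self, norm_zero, add_sub_cancel_left, neg_apply, map_add]
      linarith)
  refine ⟨ξ ∘L ContinuousLinearMap.inl ℝ E E + l, ?_, ξ ∘L ContinuousLinearMap.inr ℝ E E, ?_, ?_⟩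
  · refine mem_frechetSubdiff_of_forall (c := η) fun v => ?_
    have := hξ (v, u)
    simp only [sub_self, norm_zero, neg_apply, Prod.mk_sub_mk] at this
    simp only [add_apply, ContinuousLinearMap.comp_apply, ContinuousLinearMap.inl_apply, map_sub]
      at this ⊢
    have e : ((v - u, (0 : E)) : E × E) = (v, 0) - (u, 0) := by simp
    rw [e, map_sub] at this
    linarith
  · rw [hψ.mem_Kstar_iff]
    intro h
    have h2 := hξ (u, u + h)
    simp only [sub_self, norm_zero, Prod.mk_sub_mk, add_sub_cancel_left] at h2
    have h3 := hψ.add_le (u - w) h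
    have h4 : u - w + h = u + h - w := by abel
    rw [h4] at h3
    change ξ (0, h) ≤ ψ h
    linarith
  · ext h
    have := hV (h, h) rfl
    have e : ((h, h) : E × E) = (h, 0) + (0, h) := by simp
    rw [e, map_add] at this
    simp only [add_apply, ContinuousLinearMap.comp_apply, ContinuousLinearMap.inl_apply,
      ContinuousLinearMap.inr_apply]
    linarith

end Subdifferentials

/-! ### One incremental step -/

section IncrementalStep

lemma IsSublinear.exists_le_mul_norm [FiniteDimensional ℝ E] {ψ : E → ℝ} (hψ : IsSublinear ψ) :
    ∃ C : ℝ, 0 ≤ C ∧ ∀ v, ψ v ≤ C * ‖v‖ := by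
  obtain ⟨C, hC⟩ := (isCompact_closedBall (0 : E) 1).exists_bound_of_continuousOn
    hψ.continuous.continuousOn
  refine ⟨C, (norm_nonneg _).trans (hC 0 (by simp)), fun v => ?_⟩
  by_cases hv : v = 0
  · simp [hv, hψ.map_zero]
  have hv' : 0 < ‖v‖ := norm_pos_iff.2 hv
  have h1 := hC (‖v‖⁻¹ • v) (by simp [norm_smul, hv'.ne'])
  have h2 := hψ.smul_eq ‖v‖ hv'.le (‖v‖⁻¹ • v)
  rw [smul_inv_smul₀ hv'.ne'] at h2
  rw [h2, mul_comm]
  exact mul_le_mul_of_nonneg_right ((le_abs_self _).trans h1) hv'.le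

lemma IsSublinear.exists_mul_norm_le [FiniteDimensional ℝ E] {ψ : E → ℝ} (hψ : IsSublinear ψ)
    (hpos : ∀ v, v ≠ 0 → 0 < ψ v) : ∃ c : ℝ, 0 < c ∧ ∀ v, c * ‖v‖ ≤ ψ v := by
  rcases subsingleton_or_nontrivial E with hE | hE
  · exact ⟨1, one_pos, fun v => by simp [Subsingleton.elim v 0, hψ.map_zero]⟩
  obtain ⟨u, hu, hmin⟩ := (isCompact_sphere (0 : E) 1).exists_isMinOn
    (NormedSpace.sphere_nonempty.2 zero_le_one) hψ.continuous.continuousOn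
  have hu' : u ≠ 0 := by
    rintro rfl
    simp at hu
  refine ⟨ψ u, hpos u hu', fun v => ?_⟩
  by_cases hv : v = 0
  · simp [hv, hψ.map_zero]
  have hv' : 0 < ‖v‖ := norm_pos_iff.2 hv
  have h1 : ψ u ≤ ψ (‖v‖⁻¹ • v) := hmin (by simp [norm_smul, hv'.ne'])
  have h2 := hψ.smul_eq ‖v‖ hv'.le (‖v‖⁻¹ • v)
  rw [smul_inv_smul₀ hv'.ne'] at h2
  rw [h2, mul_comm]
  exact mul_le_mul_of_nonneg_left h1 hv'.le

lemma SemiconvexWith.frechetSubdiff_nonempty [FiniteDimensional ℝ E] {J : E → ℝ} {η : ℝ}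
    (hJ : SemiconvexWith η J) (u : E) : (frechetSubdiff J u).Nonempty := by
  have hconv := hJ.convexOn_add_sq le_rfl u
  obtain ⟨ξ, -, h2⟩ := hconv.exists_multiplier hconv.continuous_univ ⊥ u fun h hh => by
    rw [(Submodule.mem_bot ℝ).1 hh, add_zero]
  refine ⟨ξ, mem_frechetSubdiff_of_forall (c := η) fun v => ?_⟩
  have := h2 v
  simp only [sub_self, norm_zero] at this
  linarith

/-- The standing assumptions on the energy `J`, the dissipation `ψ` and the constraint operator
`A`, with explicit constants. -/
structure IsAdmissible (J ψ : E → ℝ) (A : E →L[ℝ] F) (γ η L C : ℝ) : Prop where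
  energy_nonneg : ∀ v, 0 ≤ J v
  diss_nonneg : ∀ v, 0 ≤ ψ v
  γ_pos : 0 < γ
  adj_bound : ∀ q : StrongDual ℝ F, γ * ‖q‖ ≤ ‖adj A q‖
  coercive : Tendsto (fun v => J v + ‖A v‖ ^ 2) (Bornology.cobounded E) atTop
  η_pos : 0 < η
  semiconvex : SemiconvexWith η J
  L_pos : 0 < L
  subdiff_bound : ∀ v, ∀ ξ ∈ frechetSubdiff J v, ‖ξ‖ ≤ L * (J v + 1)
  sublinear : IsSublinear ψ
  C_nonneg : 0 ≤ C
  diss_le : ∀ v, ψ v ≤ C * ‖v‖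

/-- `p` is a multiplier certifying the stability of `x`, i.e. `A* p ∈ ∂J(x) + K*`. -/
def IsStableMultiplier (J ψ : E → ℝ) (A : E →L[ℝ] F) (η : ℝ) (x : E) (p : StrongDual ℝ F) : Prop :=
  ∀ v, J x + p (A (v - x)) - η * ‖v - x‖ ^ 2 ≤ J v + ψ (v - x)

open scoped RealInnerProductSpace in
/-- One step of the incremental scheme from `x` to a critical point `x'` on the fibre over `y`.
The auxiliary point `u` is the proximal minimizer on that fibre, with multiplier `q`. -/
structure IsStep (J ψ : E → ℝ) (A : E →L[ℝ] F) (γ η L C : ℝ) (x : E) (y : F) (x' u : E)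
    (q : StrongDual ℝ F) : Prop where
  critical : IsCriticalPoint (fun v => J v + ψ (v - x)) A y x'
  energy_le : J x' + ψ (x' - x) ≤ J u + ψ (u - x)
  aux_energy_le : J u + ψ (u - x) + (η + 1) * ‖u - x‖ ^ 2 ≤ J x + q (y - A x)
  aux_stable : ∀ v, J u + q (A (v - u)) - 2 * (η + 1) * ⟪u - x, v - u⟫
    - (η + 1) * ‖v - u‖ ^ 2 ≤ J v + ψ (v - u)
  multiplier_le : γ * ‖q‖ ≤ L * (J u + 1) + C + 2 * (η + 1) * ‖u - x‖
  dist_le : ∀ p, IsStableMultiplier J ψ A η x p → ‖u - x‖ ^ 2 ≤ (q - p) (y - A x)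

namespace IsAdmissible

variable {J ψ : E → ℝ} {A : E →L[ℝ] F} {γ η L C : ℝ}

lemma norm_le_of_mem_Kstar (h : IsAdmissible J ψ A γ η L C) {ζ : StrongDual ℝ E}
    (hζ : ζ ∈ Kstar ψ) : ‖ζ‖ ≤ C := by
  rw [h.sublinear.mem_Kstar_iff] at hζ
  refine ζ.opNorm_le_bound h.C_nonneg fun v => abs_le.2 ⟨?_, (hζ v).trans (h.diss_le v)⟩
  have := (hζ (-v)).trans (h.diss_le (-v))
  rw [map_neg, norm_neg] at this
  linarith

/-- After the sum rule, (J3) bounds the part in `∂J` and `C` the part in `K*`. Here `l` is zero at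
critical points and the gradient of the penalty at proximal ones. -/
lemma multiplier_le_of_mem [FiniteDimensional ℝ E] (h : IsAdmissible J ψ A γ η L C) {w u : E}
    {p : StrongDual ℝ F} {l : StrongDual ℝ E}
    (hp : adj A p + l ∈ frechetSubdiff (fun v => J v + ψ (v - w)) u) :
    γ * ‖p‖ ≤ L * (J u + 1) + C + ‖l‖ := by
  obtain ⟨ξ, hξ, ζ, hζ, hsum⟩ :=
    h.semiconvex.exists_add_of_mem_frechetSubdiff_add h.η_pos.le h.sublinear hp
  have h1 : adj A p = ξ + ζ - l := by rw [hsum]; abel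
  calc γ * ‖p‖ ≤ ‖ξ + ζ - l‖ := h1 ▸ h.adj_bound p
    _ ≤ ‖ξ‖ + ‖ζ‖ + ‖l‖ := (norm_sub_le _ _).trans (by gcongr; exact norm_add_le _ _)
    _ ≤ _ := by
      gcongr
      exacts [h.subdiff_bound _ _ hξ, h.norm_le_of_mem_Kstar hζ]

/-- The sum rule leaves an element of `K*`, which no longer remembers the previous state `w`;
criticality thus becomes stability of `u` itself. -/
lemma exists_isStableMultiplier [FiniteDimensional ℝ E] (h : IsAdmissible J ψ A γ η L C)
    {w u : E} {y : F} (hu : IsCriticalPoint (fun v => J v + ψ (v - w)) A y u) :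
    ∃ p, γ * ‖p‖ ≤ L * (J u + 1) + C ∧ IsStableMultiplier J ψ A η u p := by
  obtain ⟨-, -, -, hp, p, rfl⟩ := hu
  refine ⟨p, by simpa using h.multiplier_le_of_mem (l := 0) (by simpa using hp), fun v => ?_⟩
  obtain ⟨ξ, hξ, ζ, hζ, hsum⟩ :=
    h.semiconvex.exists_add_of_mem_frechetSubdiff_add h.η_pos.le h.sublinear hp
  rw [h.semiconvex.mem_frechetSubdiff_iff h.η_pos.le] at hξ
  rw [h.sublinear.mem_Kstar_iff] at hζ
  have h1 : p (A (v - u)) = ξ (v - u) + ζ (v - u) := (DFunLike.congr_fun hsum (v - u)).symm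
  have h2 := hξ v
  have h3 := hζ (v - u)
  linarith

/-- A multiplier satisfying the stability inequality, with any quadratic correction, represents
an element of `∂J(u) + K*`. -/
lemma adj_mem_of_forall [FiniteDimensional ℝ E] (h : IsAdmissible J ψ A γ η L C) {c : ℝ} {u : E}
    {p : StrongDual ℝ F} (hp : IsStableMultiplier J ψ A c u p) :
    adj A p ∈ frechetSubdiff J u + Kstar ψ := by
  have h1 : adj A p ∈ frechetSubdiff (fun v => J v + ψ (v - u)) u := by
    refine mem_frechetSubdiff_of_forall (c := c) fun v => ?_
    rw [sub_self, h.sublinear.map_zero, add_zero]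
    exact hp v
  obtain ⟨ξ, hξ, ζ, hζ, hsum⟩ :=
    h.semiconvex.exists_add_of_mem_frechetSubdiff_add h.η_pos.le h.sublinear h1
  exact Set.mem_add.2 ⟨ξ, hξ, ζ, hζ, hsum⟩

lemma exists_min_on_fibre [FiniteDimensional ℝ E] [FiniteDimensional ℝ F]
    (h : IsAdmissible J ψ A γ η L C) {S : E → ℝ} (hS : Continuous S) (hJS : ∀ v, J v ≤ S v)
    (y : F) : ∃ u, A u = y ∧ ∀ v, A v = y → S u ≤ S v := by
  obtain ⟨a, ha⟩ := surjective_of_adj_lower_bound h.γ_pos h.adj_bound y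
  have hcl : IsClosed {v | A v = y ∧ S v ≤ S a} :=
    (isClosed_eq (by fun_prop) (by fun_prop)).inter (isClosed_le hS continuous_const)
  have hbd : Bornology.IsBounded {v | A v = y ∧ S v ≤ S a} := by
    -- On a fibre `‖A v‖` is constant, so (J1) bounds the sublevel sets of `J`, hence those of `S`.
    have h1 := h.coercive.eventually (eventually_gt_atTop (S a + ‖y‖ ^ 2))
    refine Bornology.IsBounded.subset (Bornology.isBounded_def.2 ?_ : Bornology.IsBounded
      {v | ¬ (S a + ‖y‖ ^ 2 < J v + ‖A v‖ ^ 2)}) ?_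
    · filter_upwards [h1] with v hv
      simpa using hv
    · rintro v ⟨h2, h3⟩
      have := hJS v
      simp only [mem_ofPred_eq, h2]
      linarith
  obtain ⟨u, hu, hmin⟩ := (Metric.isCompact_of_isClosed_isBounded hcl hbd).exists_isMinOn
    ⟨a, ha, le_rfl⟩ hS.continuousOn
  refine ⟨u, hu.1, fun v hv => ?_⟩
  by_cases h2 : S v ≤ S a
  · exact hmin ⟨hv, h2⟩
  · exact hu.2.trans (not_le.1 h2).le

open scoped RealInnerProductSpace in
-- Two minimizations on one fibre: without the penalty, to get a genuine critical point `x'`, and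
-- with it, to get a multiplier inequality free of quadratic loss.
lemma exists_isStep [FiniteDimensional ℝ E] [FiniteDimensional ℝ F]
    (h : IsAdmissible J ψ A γ η L C) (x : E) (y : F) :
    ∃ x' u q, IsStep J ψ A γ η L C x y x' u q := by
  have hA := surjective_of_adj_lower_bound h.γ_pos h.adj_bound
  have hη := h.η_pos
  have hSsc : SemiconvexWith η (fun v => J v + ψ (v - x)) :=
    h.semiconvex.add_convexOn (convexOn_translate h.sublinear.convexOn x)
  have hSc := hSsc.continuous
  obtain ⟨x', hx', hxmin⟩ := h.exists_min_on_fibre hSc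
    (fun v => le_add_of_nonneg_right (h.diss_nonneg _)) y
  obtain ⟨p, hp⟩ := hSsc.exists_multiplier hA hη.le (u := x') fun v hv =>
    hxmin v (hv.trans hx')
  have hΦ := hSsc.convexOn_add_sq (c := η + 1) (by linarith) x
  have hΦsc : SemiconvexWith 0 (fun v => (J v + ψ (v - x)) + (η + 1) * ‖v - x‖ ^ 2) := by
    simpa only [SemiconvexWith, zero_mul, add_zero] using hΦ
  obtain ⟨u, hu, humin⟩ := h.exists_min_on_fibre hΦ.continuous_univ (fun v => by
    have := h.diss_nonneg (v - x)
    have : 0 ≤ (η + 1) * ‖v - x‖ ^ 2 := by positivity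
    linarith) y
  obtain ⟨q, hq⟩ := hΦsc.exists_multiplier hA le_rfl (u := u) fun v hv =>
    humin v (hv.trans hu)
  have hq' : ∀ v, J u + ψ (u - x) + (η + 1) * ‖u - x‖ ^ 2 + q (A (v - u)) ≤
      J v + ψ (v - x) + (η + 1) * ‖v - x‖ ^ 2 := fun v => by
    have := (hΦsc.mem_frechetSubdiff_iff le_rfl).1 hq v
    rw [zero_mul, sub_zero] at this
    exact this
  have hexp : ∀ v, ‖v - x‖ ^ 2 = ‖u - x‖ ^ 2 + 2 * ⟪u - x, v - u⟫ + ‖v - u‖ ^ 2 := fun v => by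
    rw [← norm_add_sq_real]; congr 2; abel
  -- The global subgradient inequality is tested at the old state `x`, which lies on another fibre.
  have haux : J u + ψ (u - x) + (η + 1) * ‖u - x‖ ^ 2 ≤ J x + q (y - A x) := by
    have := hq' x
    rw [map_sub, hu, sub_self, norm_zero, h.sublinear.map_zero, ← neg_sub y, map_neg] at this
    linarith
  refine ⟨x', u, q, ⟨hSsc.frechetSubdiff_nonempty, hx', adj A p, hp, p, rfl⟩,
    hxmin u hu, haux, fun v => ?_, ?_, fun p hp => ?_⟩
  · have h1 := hq' v
    rw [hexp v] at h1
    have h2 := h.sublinear.add_le (v - u) (u - x)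
    rw [sub_add_sub_cancel] at h2
    linarith
  · have hmem : adj A q + (-(2 * (η + 1))) • innerSL ℝ (u - x) ∈
        frechetSubdiff (fun v => J v + ψ (v - x)) u := by
      refine mem_frechetSubdiff_of_forall (c := η + 1) fun v => ?_
      have h1 := hq' v
      rw [hexp v] at h1
      have h2 : (adj A q + (-(2 * (η + 1))) • innerSL ℝ (u - x)) (v - u) =
        q (A (v - u)) - 2 * (η + 1) * ⟪u - x, v - u⟫ := by
        simp only [add_apply, smul_apply, innerSL_apply_apply, smul_eq_mul, adj,
          ContinuousLinearMap.comp_apply]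
        ring
      rw [h2]
      linarith
    have := h.multiplier_le_of_mem hmem
    rwa [norm_smul, innerSL_apply_norm, norm_neg, Real.norm_of_nonneg (by positivity)] at this
  -- Stability of `x` tested at `u` loses `η ‖u - x‖²`, while `haux` gains `(η + 1) ‖u - x‖²`; the
  -- extra unit in the penalty is what remains.
  · have h1 := hp u
    rw [map_sub, hu] at h1
    rw [sub_apply]
    linarith

end IsAdmissible

end IncrementalStep

/-! ### A priori bounds and Helly's principle -/

section DiscreteEstimates

lemma discrete_gronwall {a x : ℕ → ℝ} {c : ℝ} (ha : ∀ n, 0 ≤ a n)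
    (h : ∀ n, a (n + 1) ≤ a n * (1 + c * x n)) (n : ℕ) :
    a n ≤ a 0 * Real.exp (c * ∑ i ∈ Finset.range n, x i) := by
  induction n with
  | zero => simp
  | succ n ih =>
    rw [Finset.sum_range_succ, mul_add, Real.exp_add, ← mul_assoc]
    calc a (n + 1) ≤ a n * (1 + c * x n) := h n
      _ ≤ a n * Real.exp (c * x n) := by
        refine mul_le_mul_of_nonneg_left ?_ (ha n)
        rw [add_comm]
        exact Real.add_one_le_exp _
      _ ≤ _ := mul_le_mul_of_nonneg_right ih (Real.exp_pos _).le

variable {J ψ : E → ℝ} {A : E →L[ℝ] F} {γ η L C : ℝ}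

lemma IsStep.energy_step {x x' u : E} {y : F} {q : StrongDual ℝ F}
    (hs : IsStep J ψ A γ η L C x y x' u q) (hη : 0 ≤ η) :
    J x' + ψ (x' - x) ≤ J x + q (y - A x) := by
  have h1 := hs.energy_le
  have h2 := hs.aux_energy_le
  have h3 : 0 ≤ (η + 1) * ‖u - x‖ ^ 2 := by positivity
  linarith

/-- The energy of `u` bounds `q` and `q` bounds the energy of `u`; a small increment of the
constraint closes the loop by absorbing half of `‖q‖`. -/
lemma IsAdmissible.norm_multiplier_le (h : IsAdmissible J ψ A γ η L C) {x x' u : E} {y : F}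
    {q : StrongDual ℝ F} (hs : IsStep J ψ A γ η L C x y x' u q)
    (hy : (L + C + η + 2) / γ * ‖y - A x‖ ≤ 1 / 2) :
    ‖q‖ ≤ 2 * ((L + C + η + 2) / γ) * (J x + 1) := by
  have hγ := h.γ_pos
  have hη := h.η_pos
  have hL := h.L_pos
  have hC := h.C_nonneg
  have hJu := h.energy_nonneg u
  set K := (L + C + η + 2) / γ with hK
  have hK0 : 0 ≤ K := by positivity
  set Z := (η + 1) * ‖u - x‖ ^ 2 with hZ
  have hZ0 : 0 ≤ Z := by positivity
  have h1 : γ * ‖q‖ ≤ (L + C + η + 2) * (J u + Z + 1) := by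
    have h2 := hs.multiplier_le
    have h3 : 2 * (η + 1) * ‖u - x‖ ≤ Z + (η + 1) := by
      rw [hZ]; nlinarith [sq_nonneg (‖u - x‖ - 1)]
    nlinarith [mul_nonneg hL.le hZ0, mul_nonneg hC hZ0, mul_nonneg hC hJu, mul_nonneg hη.le hZ0,
      mul_nonneg hη.le hJu]
  have h2 : ‖q‖ ≤ K * (J u + Z + 1) := by
    rw [hK, div_mul_eq_mul_div, le_div_iff₀ hγ]; linarith
  have h3 : q (y - A x) ≤ ‖q‖ * ‖y - A x‖ := (le_abs_self _).trans (q.le_opNorm _)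
  have h4 := hs.aux_energy_le
  have h5 := h.diss_nonneg (u - x)
  have h6 : K * (J u + Z + 1) ≤ K * (J x + 1 + ‖q‖ * ‖y - A x‖) :=
    mul_le_mul_of_nonneg_left (by linarith) hK0
  have h7 := mul_le_mul_of_nonneg_left hy (norm_nonneg q)
  nlinarith

/-- A priori bounds for the incremental scheme, uniform over all data `g` of variation at most
`B` with small increments. -/
lemma IsAdmissible.exists_discrete [FiniteDimensional ℝ E] [FiniteDimensional ℝ F]
    (h : IsAdmissible J ψ A γ η L C) {v₀ : E} {y₀ : F}
    (hv₀ : IsCriticalPoint (fun v => J v + ψ (v - v₀)) A y₀ v₀) (B : ℝ) :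
    ∃ ρ > 0, ∃ M : ℝ, ∀ g : ℕ → F, g 0 = y₀ →
      (∀ n, ∑ i ∈ Finset.range n, ‖g (i + 1) - g i‖ ≤ B) → (∀ i, ‖g (i + 1) - g i‖ ≤ ρ) →
      ∃ (V U : ℕ → E) (Q : ℕ → StrongDual ℝ F), V 0 = v₀ ∧
        (∀ i, IsStep J ψ A γ η L C (V i) (g (i + 1)) (V (i + 1)) (U i) (Q i)) ∧
        (∀ i, A (V i) = g i) ∧ (∀ i, ‖Q i‖ ≤ M) ∧
        (∀ i, ‖U i - V i‖ ^ 2 ≤ M * ‖g (i + 1) - g i‖) ∧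
        ∀ n, ∑ i ∈ Finset.range n, ψ (V (i + 1) - V i) ≤ M := by
  have hγ := h.γ_pos
  have hη := h.η_pos
  have hL := h.L_pos
  have hC := h.C_nonneg
  set K := (L + C + η + 2) / γ with hK
  have hK0 : 0 < K := by positivity
  -- `M₀` is the Gronwall bound for `J + 1`, `M₁` then bounds the multipliers `Q`, and `M₂` bounds
  -- `Q - p` for stable multipliers `p`.
  set M₀ := (J v₀ + 1) * Real.exp (2 * K * B) with hM₀
  have hM₀0 : 0 ≤ M₀ := by have := h.energy_nonneg v₀; positivity
  set M₁ := 2 * K * M₀ with hM₁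
  have hM₁0 : 0 ≤ M₁ := by positivity
  set M₂ := M₁ + (L * M₀ + C) / γ with hM₂
  have hM₁₂ : M₁ ≤ M₂ := by
    have : 0 ≤ (L * M₀ + C) / γ := by positivity
    linarith
  -- The increment bound `1 / (2 * K)` is what the absorption in `norm_multiplier_le` requires.
  refine ⟨1 / (2 * K), by positivity, max M₂ (J v₀ + M₁ * B), fun g hg0 hgB hgρ => ?_⟩
  choose X U Q hX using h.exists_isStep
  set V : ℕ → E := fun n => Nat.rec v₀ (fun i x => X x (g (i + 1))) n with hV
  have hstep : ∀ i, IsStep J ψ A γ η L C (V i) (g (i + 1)) (V (i + 1)) (U (V i) (g (i + 1)))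
      (Q (V i) (g (i + 1))) := fun i => hX (V i) (g (i + 1))
  have hAV : ∀ i, A (V i) = g i := by
    rintro (_ | i)
    · exact hv₀.2.1.trans hg0.symm
    · exact (hstep i).critical.2.1
  have hsmall : ∀ i, K * ‖g (i + 1) - A (V i)‖ ≤ 1 / 2 := fun i => by
    rw [hAV]
    calc K * ‖g (i + 1) - g i‖ ≤ K * (1 / (2 * K)) := mul_le_mul_of_nonneg_left (hgρ i) hK0.le
      _ = 1 / 2 := by field_simp
  have hQ := fun i => h.norm_multiplier_le (hstep i) (hsmall i)
  have hes : ∀ i, J (V (i + 1)) + ψ (V (i + 1) - V i) ≤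
      J (V i) + ‖Q (V i) (g (i + 1))‖ * ‖g (i + 1) - g i‖ := fun i => by
    have h1 := (hstep i).energy_step hη.le
    rw [hAV] at h1
    exact h1.trans (by gcongr; exact (Real.le_norm_self _).trans (ContinuousLinearMap.le_opNorm _ _))
  have hJV : ∀ i, J (V i) + 1 ≤ M₀ := fun i => by
    have h1 := discrete_gronwall (a := fun i => J (V i) + 1) (x := fun i => ‖g (i + 1) - g i‖)
      (c := 2 * K) (fun n => by have := h.energy_nonneg (V n); positivity) (fun n => by
        have h2 := hes n
        have h3 := h.diss_nonneg (V (n + 1) - V n)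
        have h4 := mul_le_mul_of_nonneg_right (hQ n) (norm_nonneg (g (n + 1) - g n))
        linarith) i
    refine h1.trans ?_
    have := h.energy_nonneg v₀
    exact mul_le_mul_of_nonneg_left (Real.exp_le_exp.2
      (mul_le_mul_of_nonneg_left (hgB i) (by positivity))) (by positivity)
  have hQM : ∀ i, ‖Q (V i) (g (i + 1))‖ ≤ M₁ := fun i =>
    (hQ i).trans (mul_le_mul_of_nonneg_left (hJV i) (by positivity))
  refine ⟨V, fun i => U (V i) (g (i + 1)), fun i => Q (V i) (g (i + 1)), rfl, hstep, hAV,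
    fun i => (hQM i).trans (hM₁₂.trans (le_max_left _ _)), fun i => ?_, fun n => ?_⟩
  · obtain ⟨p, hp1, hp2⟩ : ∃ p, γ * ‖p‖ ≤ L * (J (V i) + 1) + C ∧
        IsStableMultiplier J ψ A η (V i) p := by
      rcases i with _ | i
      · exact h.exists_isStableMultiplier hv₀
      · exact h.exists_isStableMultiplier (hstep i).critical
    have h1 := (hstep i).dist_le p hp2
    rw [hAV] at h1
    have hp3 : ‖p‖ ≤ (L * M₀ + C) / γ := by
      rw [le_div_iff₀ hγ, mul_comm]
      exact hp1.trans (by gcongr; exact hJV i)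
    refine h1.trans (((Real.le_norm_self _).trans (ContinuousLinearMap.le_opNorm _ _)).trans ?_)
    gcongr
    exact ((norm_sub_le _ _).trans (add_le_add (hQM i) hp3)).trans (le_max_left _ _)
  · have h1 : ∀ n, J (V n) + ∑ i ∈ Finset.range n, ψ (V (i + 1) - V i) ≤
        J v₀ + M₁ * ∑ i ∈ Finset.range n, ‖g (i + 1) - g i‖ := by
      intro n
      induction n with
      | zero => simp [hV]
      | succ n ih =>
        rw [Finset.sum_range_succ, Finset.sum_range_succ, mul_add]
        have h2 := hes n
        have h3 := mul_le_mul_of_nonneg_right (hQM n) (norm_nonneg (g (n + 1) - g n))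
        linarith
    have h2 := h1 n
    have h3 := h.energy_nonneg (V n)
    have h4 := mul_le_mul_of_nonneg_left (hgB n) hM₁0
    exact le_trans (by linarith) (le_max_right _ _)

/-- Helly's selection principle, for maps whose increments are controlled by those of uniformly
bounded monotone functions. -/
lemma exists_subseq_tendsto_of_monotone_control [FiniteDimensional ℝ E] {w : ℕ → ℝ → E}
    {α : ℕ → ℝ → ℝ} {M R : ℝ} (hα : ∀ k, Monotone (α k)) (hαM : ∀ k t, |α k t| ≤ M)
    (hw : ∀ k s t, s ≤ t → ‖w k t - w k s‖ ≤ α k t - α k s) (hwR : ∀ k t, ‖w k t‖ ≤ R) :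
    ∃ (φ : ℕ → ℕ) (v : ℝ → E) (a : ℝ → ℝ), StrictMono φ ∧ Monotone a ∧
      (∀ s t, s ≤ t → ‖v t - v s‖ ≤ a t - a s) ∧
      ∀ t, Tendsto (fun k => w (φ k) t) atTop (𝓝 (v t)) := by
  -- Compactness along an ultrafilter gives candidate limits at all times at once; a true
  -- subsequence is extracted afterwards.
  set U : Ultrafilter ℕ := hyperfilter ℕ
  have hU : (U : Filter ℕ) ≤ atTop := by
    rw [← Nat.cofinite_eq_atTop]; exact hyperfilter_le_cofinite
  have hv : ∀ t, ∃ x, Tendsto (fun k => w k t) U (𝓝 x) := fun t => by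
    obtain ⟨x, -, hx⟩ := (isCompact_closedBall (0 : E) R).ultrafilter_le_nhds (U.map (w · t))
      (Filter.le_principal_iff.2 (Filter.mem_map.2 <| univ_mem' fun k => by
        simpa using hwR k t))
    exact ⟨x, hx⟩
  have ha : ∀ t, ∃ x, Tendsto (fun k => α k t) U (𝓝 x) := fun t => by
    obtain ⟨x, -, hx⟩ := (isCompact_closedBall (0 : ℝ) M).ultrafilter_le_nhds (U.map (α · t))
      (Filter.le_principal_iff.2 (Filter.mem_map.2 <| univ_mem' fun k => by
        simpa using hαM k t))
    exact ⟨x, hx⟩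
  choose v hv using hv
  choose a ha using ha
  have hamono : Monotone a := fun s t hst =>
    le_of_tendsto_of_tendsto' (ha s) (ha t) fun k => hα k hst
  have hva : ∀ s t, s ≤ t → ‖v t - v s‖ ≤ a t - a s := fun s t hst =>
    le_of_tendsto_of_tendsto' ((hv t).sub (hv s)).norm ((ha t).sub (ha s)) fun k => hw k s t hst
  -- A countable product of metric spaces is first countable, so the cluster point on `D` is the
  -- limit of a subsequence. Times outside `D` are continuity points of `a`.
  set D : Set ℝ := {t | ¬ ContinuousAt a t} ∪ range ((↑) : ℚ → ℝ)
  have hDc : Countable D :=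
    (hamono.countable_not_continuousAt.union (countable_range _)).to_subtype
  have hlim : Tendsto (fun k (d : D) => (w k d, α k d)) U (𝓝 fun d : D => (v d, a d)) :=
    tendsto_pi_nhds.2 fun d => (hv d).prodMk_nhds (ha d)
  have hcl : MapClusterPt (fun d : D => (v d, a d)) atTop
      (fun k (d : D) => (w k d, α k d)) := hlim.mapClusterPt.mono hU
  obtain ⟨φ, hφ, hlim'⟩ := hcl.tendsto_subseq
  have hD : ∀ d ∈ D, Tendsto (fun k => w (φ k) d) atTop (𝓝 (v d)) ∧
      Tendsto (fun k => α (φ k) d) atTop (𝓝 (a d)) := fun d hd => by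
    have := tendsto_pi_nhds.1 hlim' ⟨d, hd⟩
    exact ⟨(continuous_fst.tendsto _).comp this, (continuous_snd.tendsto _).comp this⟩
  refine ⟨φ, v, a, hφ, hamono, hva, fun t => ?_⟩
  by_cases ht : ContinuousAt a t
  · rw [Metric.tendsto_atTop']
    intro ε hε
    obtain ⟨r, hr, hball⟩ := Metric.continuousAt_iff.1 ht (ε / 8) (by positivity)
    -- Rationals on both sides of `t` squeeze the oscillation: `‖w t - w d‖` is at most the
    -- increment of `α` from `d` to `d'`, which is eventually small.
    obtain ⟨d, hd1, hd2⟩ := exists_rat_btwn (show t - r < t by linarith)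
    obtain ⟨d', hd1', hd2'⟩ := exists_rat_btwn (show t < t + r by linarith)
    have h1 := hball (x := d) (by rw [Real.dist_eq, abs_lt]; constructor <;> linarith)
    have h2 := hball (x := d') (by rw [Real.dist_eq, abs_lt]; constructor <;> linarith)
    rw [Real.dist_eq, abs_lt] at h1 h2
    have hdD := hD d (Or.inr ⟨d, rfl⟩)
    have hdD' := hD d' (Or.inr ⟨d', rfl⟩)
    have h3 := (hdD'.2.sub hdD.2).eventually (gt_mem_nhds (show a d' - a d < ε / 4 by linarith))
    have h4 := (Metric.tendsto_nhds.1 hdD.1) (ε / 4) (by positivity)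
    obtain ⟨N, hN⟩ := eventually_atTop.1 (h3.and h4)
    refine ⟨N, fun k hk => ?_⟩
    obtain ⟨h5, h6⟩ := hN k hk.le
    have h7 := hw (φ k) d t hd2.le
    have h8 := hα (φ k) hd1'.le
    have h9 := hva d t hd2.le
    rw [dist_eq_norm] at h6 ⊢
    have h10 : w (φ k) t - v t = (w (φ k) t - w (φ k) d) + (w (φ k) d - v d) - (v t - v d) := by
      abel
    rw [h10]
    have h11 := norm_sub_le ((w (φ k) t - w (φ k) d) + (w (φ k) d - v d)) (v t - v d)
    have h12 := norm_add_le (w (φ k) t - w (φ k) d) (w (φ k) d - v d)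
    linarith
  · exact (hD t (Or.inl ht)).1

lemma boundedVariationOn_of_monotone_control {X : Type*} [SeminormedAddCommGroup X] {v : ℝ → X} {a : ℝ → ℝ} (ha : Monotone a)
    (h : ∀ s t, s ≤ t → ‖v t - v s‖ ≤ a t - a s) (x y : ℝ) :
    BoundedVariationOn v (Icc x y) := by
  have h1 : eVariationOn v (Icc x y) ≤ eVariationOn a (Icc x y) := by
    refine iSup_le fun p => ?_
    refine le_trans (Finset.sum_le_sum fun i _ => ?_)
      (eVariationOn.sum_le (f := a) (n := p.1) p.2.2.1 p.2.2.2)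
    rw [edist_dist, edist_dist, dist_eq_norm, Real.dist_eq]
    exact ENNReal.ofReal_le_ofReal ((h _ _ (p.2.2.1 (Nat.le_succ i))).trans (le_abs_self _))
  refine ne_top_of_le_ne_top ?_ h1
  rcases le_or_gt x y with hxy | hxy
  · have := (ha.monotoneOn (Icc x y)).eVariationOn_eq (left_mem_Icc.2 hxy) (right_mem_Icc.2 hxy)
    rw [Set.inter_self] at this
    rw [this]
    exact ENNReal.ofReal_ne_top
  · simp [Icc_eq_empty hxy.not_ge]

end DiscreteEstimates

/-! ### Weak limits and absolutely continuous functions -/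

section Measure

section WeakLimits

open scoped RealInnerProductSpace

variable {Ω : Type*} {mΩ : MeasurableSpace Ω} {μ : Measure Ω} [IsFiniteMeasure μ]

/-- A uniformly bounded sequence of maps has a weak `L²` limit along any ultrafilter. -/
lemma exists_weak_limit [CompleteSpace F] {q : ℕ → Ω → F}
    (hq : ∀ k, AEStronglyMeasurable (q k) μ) {M : ℝ} (hM : ∀ k s, ‖q k s‖ ≤ M)
    (U : Ultrafilter ℕ) :
    ∃ r : Ω → F, MemLp r 2 μ ∧ ∀ φ : Ω → F, MemLp φ 2 μ →
      Tendsto (fun k => ∫ s, ⟪q k s, φ s⟫ ∂μ) U (𝓝 (∫ s, ⟪r s, φ s⟫ ∂μ)) := by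
  have hqL : ∀ k, MemLp (q k) 2 μ := fun k =>
    MemLp.of_bound (hq k) M (Eventually.of_forall (hM k))
  have hM' : ∀ k s, ‖q k s‖ ≤ max M 0 := fun k s => (hM k s).trans (le_max_left _ _)
  set R : ℝ := measureUnivNNReal μ ^ (2 : ℝ≥0∞).toReal⁻¹ * max M 0
  -- By Riesz representation the sequence lies in a ball of the dual of `L²`, weak-* compact by
  -- Banach–Alaoglu.
  set x : ℕ → WeakDual ℝ (Lp F 2 μ) := fun k =>
    StrongDual.toWeakDual (InnerProductSpace.toDual ℝ (Lp F 2 μ) ((hqL k).toLp (q k)))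
  have hx : ∀ k, x k ∈ WeakDual.toStrongDual ⁻¹'
      Metric.closedBall (0 : StrongDual ℝ (Lp F 2 μ)) R := by
    intro k
    refine (mem_closedBall_zero_iff (E := StrongDual ℝ (Lp F 2 μ))).2 ?_
    change ‖InnerProductSpace.toDual ℝ (Lp F 2 μ) ((hqL k).toLp (q k))‖ ≤ R
    rw [LinearIsometryEquiv.norm_map]
    refine Lp.norm_le_of_ae_bound (le_max_right _ _) ?_
    filter_upwards [(hqL k).coeFn_toLp] with s hs
    rw [hs]
    exact hM' k s
  obtain ⟨l, -, hl⟩ := (WeakDual.isCompact_closedBall (𝕜 := ℝ) (0 : StrongDual ℝ (Lp F 2 μ))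
    R).ultrafilter_le_nhds (U.map x) (Filter.le_principal_iff.2 (Filter.mem_map.2 <|
      univ_mem' hx))
  set r : Lp F 2 μ := (InnerProductSpace.toDual ℝ (Lp F 2 μ)).symm (WeakDual.toStrongDual l)
  refine ⟨r, Lp.memLp r, fun φ hφ => ?_⟩
  have h1 : Tendsto (fun k => x k (hφ.toLp φ)) U (𝓝 (l (hφ.toLp φ))) :=
    ((WeakDual.eval_continuous (hφ.toLp φ)).tendsto l).comp hl
  have h2 : ∀ k, x k (hφ.toLp φ) = ∫ s, ⟪q k s, φ s⟫ ∂μ := fun k => by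
    change ⟪(hqL k).toLp (q k), hφ.toLp φ⟫ = _
    rw [L2.inner_def]
    refine integral_congr_ae ?_
    filter_upwards [(hqL k).coeFn_toLp, hφ.coeFn_toLp] with s h3 h4
    rw [h3, h4]
  have h3 : l (hφ.toLp φ) = ∫ s, ⟪r s, φ s⟫ ∂μ := by
    have : ⟪r, hφ.toLp φ⟫ = l (hφ.toLp φ) := InnerProductSpace.toDual_symm_apply
    rw [← this, L2.inner_def]
    refine integral_congr_ae ?_
    filter_upwards [hφ.coeFn_toLp] with s h4
    rw [h4]
  rw [← h3]
  exact h1.congr h2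

lemma _root_.MeasureTheory.MemLp.integrable_inner_two {μ : Measure Ω} {f g : Ω → F}
    (hf : MemLp f 2 μ)
    (hg : MemLp g 2 μ) : Integrable (fun s => ⟪f s, g s⟫) μ := by
  refine (L2.integrable_inner (𝕜 := ℝ) (hf.toLp f) (hg.toLp g)).congr ?_
  filter_upwards [hf.coeFn_toLp, hg.coeFn_toLp] with s h1 h2
  rw [h1, h2]

/-- Pointwise inequalities with convergent, bounded right-hand sides pass to weak limits. -/
lemma inner_weak_limit_le {q : ℕ → Ω → F} {r φ : Ω → F} {U : Ultrafilter ℕ}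
    (hU : (U : Filter ℕ) ≤ atTop) (hq : ∀ k, MemLp (q k) 2 μ) (hr : MemLp r 2 μ)
    (hlim : ∀ φ : Ω → F, MemLp φ 2 μ →
      Tendsto (fun k => ∫ s, ⟪q k s, φ s⟫ ∂μ) U (𝓝 (∫ s, ⟪r s, φ s⟫ ∂μ)))
    (hφ : MemLp φ 2 μ) {R : ℕ → Ω → ℝ} {R' : Ω → ℝ} {C : ℝ}
    (hR : ∀ k, AEStronglyMeasurable (R k) μ) (hRC : ∀ k, ∀ᵐ s ∂μ, ‖R k s‖ ≤ C)
    (hRlim : ∀ᵐ s ∂μ, Tendsto (fun k => R k s) atTop (𝓝 (R' s)))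
    (hle : ∀ k, ∀ᵐ s ∂μ, ⟪q k s, φ s⟫ ≤ R k s) :
    ∀ᵐ s ∂μ, ⟪r s, φ s⟫ ≤ R' s := by
  have hR'm : AEStronglyMeasurable R' μ := aestronglyMeasurable_of_tendsto_ae atTop hR hRlim
  have hR' : Integrable R' μ := by
    refine Integrable.of_bound hR'm C ?_
    filter_upwards [hRlim, ae_all_iff.2 hRC] with s h1 h2
    exact le_of_tendsto' h1.norm h2
  -- Testing the weak limit with `φ` cut off to `S` localizes the inequality to arbitrary measurable
  -- sets.
  refine ae_le_of_forall_setIntegral_le (hr.integrable_inner_two hφ) hR' fun S hS _ => ?_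
  have h1 : Tendsto (fun k => ∫ s in S, ⟪q k s, φ s⟫ ∂μ) U (𝓝 (∫ s in S, ⟪r s, φ s⟫ ∂μ)) := by
    have h2 : ∀ p : Ω → F, ∫ s, ⟪p s, S.indicator φ s⟫ ∂μ = ∫ s in S, ⟪p s, φ s⟫ ∂μ := fun p => by
      rw [← integral_indicator hS]
      refine integral_congr_ae (Eventually.of_forall fun s => ?_)
      by_cases hs : s ∈ S <;> simp [hs]
    simpa only [h2] using hlim (S.indicator φ) (hφ.indicator hS)
  have h2 : Tendsto (fun k => ∫ s in S, R k s ∂μ) U (𝓝 (∫ s in S, R' s ∂μ)) := by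
    refine Tendsto.mono_left ?_ hU
    exact tendsto_integral_of_dominated_convergence (fun _ => C) (fun k => (hR k).restrict)
      (integrable_const C) (fun k => ae_restrict_of_ae (hRC k)) (ae_restrict_of_ae hRlim)
  refine le_of_tendsto_of_tendsto' h1 h2 fun k => ?_
  exact setIntegral_mono_ae ((hq k).integrable_inner_two hφ).integrableOn
    (Integrable.of_bound (hR k) C (hRC k)).integrableOn (hle k)

end WeakLimits

section AbsolutelyContinuous

variable {f : ℝ → F} {a b : ℝ}

lemma _root_.AbsolutelyContinuousOnInterval.clm_comp (hf : AbsolutelyContinuousOnInterval f a b)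
    (p : StrongDual ℝ F) : AbsolutelyContinuousOnInterval (fun s => p (f s)) a b := by
  refine squeeze_zero (fun _ => Finset.sum_nonneg fun _ _ => dist_nonneg) (fun I => ?_)
    (by simpa using Tendsto.const_mul ‖p‖ hf)
  rw [Finset.mul_sum]
  refine Finset.sum_le_sum fun i _ => ?_
  rw [dist_eq_norm, dist_eq_norm, ← map_sub]
  exact p.le_opNorm _

/-- The fundamental theorem of calculus for vector-valued absolutely continuous functions, in
weak form. -/
lemma _root_.AbsolutelyContinuousOnInterval.integral_clm_deriv [FiniteDimensional ℝ F]
    (hf : AbsolutelyContinuousOnInterval f a b) (p : StrongDual ℝ F) :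
    ∫ s in a..b, p (deriv f s) = p (f b - f a) := by
  rw [map_sub, ← (hf.clm_comp p).integral_deriv_eq_sub]
  refine intervalIntegral.integral_congr_ae ?_
  filter_upwards [hf.boundedVariationOn.ae_differentiableAt_of_mem_uIcc] with s hs hsab
  exact (p.hasFDerivAt.comp_hasDerivAt s (hs (uIoc_subset_uIcc hsab)).hasDerivAt).deriv.symm

end AbsolutelyContinuous

end Measure

/-! ### Piecewise constant interpolation -/

section TimeDiscretization

/-- The step function on the half-line taking the value `V i` on `[i δ, (i + 1) δ)`. -/
noncomputable def stepFn {X : Type*} (δ : ℝ) (V : ℕ → X) (t : ℝ) : X := V ⌊t / δ⌋₊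

section stepFn

variable {X : Type*} {δ : ℝ}

lemma floor_div_eq (hδ : 0 < δ) {i : ℕ} {t : ℝ} (ht : t ∈ Ico (i * δ) ((i + 1) * δ)) :
    ⌊t / δ⌋₊ = i := by
  have h1 : (i : ℝ) ≤ t / δ := (le_div_iff₀ hδ).2 ht.1
  rw [Nat.floor_eq_iff ((Nat.cast_nonneg i).trans h1)]
  exact ⟨h1, (div_lt_iff₀ hδ).2 ht.2⟩

lemma stepFn_eq (hδ : 0 < δ) (V : ℕ → X) {i : ℕ} {t : ℝ}
    (ht : t ∈ Ico (i * δ) ((i + 1) * δ)) : stepFn δ V t = V i := by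
  rw [stepFn, floor_div_eq hδ ht]

lemma stepFn_mul (hδ : 0 < δ) (V : ℕ → X) (i : ℕ) : stepFn δ V (i * δ) = V i :=
  stepFn_eq hδ V ⟨le_rfl, by nlinarith⟩

/-- Negative times are included, as the natural floor is `0` there; this supplies the initial
condition on `[-δ, 0)` and the state preceding step `0`. -/
lemma stepFn_of_lt (hδ : 0 < δ) (V : ℕ → X) {t : ℝ} (ht : t < δ) : stepFn δ V t = V 0 := by
  rw [stepFn, Nat.floor_eq_zero.2 ((div_lt_one hδ).2 ht)]

lemma floor_div_mono (hδ : 0 < δ) {s t : ℝ} (hst : s ≤ t) : ⌊s / δ⌋₊ ≤ ⌊t / δ⌋₊ :=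
  Nat.floor_mono (div_le_div_of_nonneg_right hst hδ.le)

lemma floor_div_mul_le (hδ : 0 < δ) {t : ℝ} (ht : 0 ≤ t) : ⌊t / δ⌋₊ * δ ≤ t :=
  (le_div_iff₀ hδ).1 (Nat.floor_le (div_nonneg ht hδ.le))

lemma lt_floor_div_add_one_mul (hδ : 0 < δ) (t : ℝ) : t < (⌊t / δ⌋₊ + 1) * δ :=
  (div_lt_iff₀ hδ).1 (Nat.lt_floor_add_one _)

lemma stronglyMeasurable_stepFn [TopologicalSpace X] (δ : ℝ) (V : ℕ → X) :
    StronglyMeasurable (stepFn δ V) :=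
  (StronglyMeasurable.of_discrete (f := V)).comp_measurable
    (Nat.measurable_floor.comp (measurable_id.div_const δ))

end stepFn

open scoped RealInnerProductSpace in
/-- The time-discrete approximations: the evolution `w`, the auxiliary states `u`, the multipliers
`q` (as vectors of `F`) and the accumulated dissipation `α`. -/
structure IsTimeDiscretization (J ψ : E → ℝ) (A : E →L[ℝ] F) (f : ℝ → F) (T : ℝ) (v₀ : E)
    (η M δ : ℝ) (w u : ℝ → E) (q : ℝ → F) (α : ℝ → ℝ) : Prop where
  evolution : IsDiscreteEvolution J ψ A f T v₀ δ w
  stronglyMeasurable : StronglyMeasurable w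
  stronglyMeasurable_aux : StronglyMeasurable u
  stronglyMeasurable_multiplier : StronglyMeasurable q
  monotone : Monotone α
  abs_le : ∀ t, |α t| ≤ M
  diss_le : ∀ s t, s ≤ t → ψ (w t - w s) ≤ α t - α s
  zero_eq : w 0 = v₀
  multiplier_le : ∀ t, ‖q t‖ ≤ M
  map_eq : ∀ t, A (w t) = f (min (⌊t / δ⌋₊ * δ) T)
  dist_sq_le : ∀ t, ‖u t - w t‖ ^ 2 ≤
    M * ‖f (min ((⌊t / δ⌋₊ + 1) * δ) T) - f (min (⌊t / δ⌋₊ * δ) T)‖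
  aux_stable : ∀ t v, J (u t) + ⟪q t, A (v - u t)⟫ - 2 * (η + 1) * ⟪u t - w t, v - u t⟫
    - (η + 1) * ‖v - u t‖ ^ 2 ≤ J v + ψ (v - u t)
  energy : ∀ t₁ t₂, 0 ≤ t₁ → t₁ ≤ t₂ → t₂ ≤ T → J (w t₂) + (α t₂ - α t₁) ≤
    J (w t₁) + ∫ s in (⌊t₁ / δ⌋₊ * δ)..(⌊t₂ / δ⌋₊ * δ), ⟪q s, deriv f s⟫

lemma isDiscreteEvolution_stepFn {J ψ : E → ℝ} {A : E →L[ℝ] F} {f : ℝ → F} {T δ : ℝ} {v₀ : E}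
    (hδ : 0 < δ) {V : ℕ → E} (hV : V 0 = v₀)
    (h0 : IsCriticalPoint (fun v => J v + ψ (v - v₀)) A (f 0) v₀)
    (h : ∀ i : ℕ, (i + 1 : ℝ) * δ ≤ T →
      IsCriticalPoint (fun v => J v + ψ (v - V i)) A (f ((i + 1) * δ)) (V (i + 1))) :
    IsDiscreteEvolution J ψ A f T v₀ δ (stepFn δ V) where
  step_pos := hδ
  right_continuous t ht := by
    refine (continuousWithinAt_const (b := stepFn δ V t)).congr_of_eventuallyEq_of_mem
      ?_ (left_mem_Icc.2 ht.2)
    have h1 : ∀ᶠ s in 𝓝 t, s < (⌊t / δ⌋₊ + 1) * δ :=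
      gt_mem_nhds (lt_floor_div_add_one_mul hδ t)
    filter_upwards [mem_nhdsWithin_of_mem_nhds h1, self_mem_nhdsWithin] with s hs hst
    rw [stepFn, stepFn]
    congr 1
    refine le_antisymm ?_ (floor_div_mono hδ hst.1)
    refine Nat.lt_add_one_iff.1 ((Nat.floor_lt' (Nat.succ_ne_zero _)).2 ?_)
    rw [div_lt_iff₀ hδ]
    exact_mod_cast hs
  initial t ht := by rw [stepFn_of_lt hδ V ht.2.2, hV]
  piecewise_const i _ t ht := by rw [stepFn_eq hδ V ht.2, stepFn_mul hδ]
  critical i hi := by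
    rcases i with _ | i
    · rw [stepFn_mul hδ, hV]
      have h1 : stepFn δ V ((((0 : ℕ) : ℝ) - 1) * δ) = v₀ := by
        rw [stepFn_of_lt hδ V (by push_cast; linarith), hV]
      rw [h1]
      simpa using h0
    · rw [stepFn_mul hδ]
      have h1 : stepFn δ V ((((i + 1 : ℕ) : ℝ) - 1) * δ) = V i := by
        rw [← stepFn_mul hδ V i]; congr 1; push_cast; ring
      rw [h1]
      push_cast at hi ⊢
      exact h i hi

open scoped RealInnerProductSpace in
lemma sum_multiplier_eq_integral [FiniteDimensional ℝ F] {f : ℝ → F} {T δ M : ℝ}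
    (hf : AbsolutelyContinuousOnInterval f 0 T) (hf' : IntegrableOn (deriv f) (Icc 0 T))
    (hδ : 0 < δ) {q : ℕ → F} (hq : ∀ i, ‖q i‖ ≤ M) {m n : ℕ} (hmn : m ≤ n) (hn : n * δ ≤ T) :
    ∑ i ∈ Finset.Ico m n, ⟪q i, f ((i + 1) * δ) - f (i * δ)⟫ =
      ∫ s in (m * δ)..(n * δ), ⟪stepFn δ q s, deriv f s⟫ := by
  have hbound : ∀ i ∈ Ico m n, 0 ≤ (i : ℝ) * δ ∧ (i : ℝ) * δ ≤ ((i : ℝ) + 1) * δ ∧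
      ((i : ℝ) + 1) * δ ≤ T := fun i hi => by
    refine ⟨by positivity, by nlinarith, le_trans ?_ hn⟩
    have : ((i : ℝ) + 1) ≤ n := by exact_mod_cast hi.2
    gcongr
  have hint : IntegrableOn (fun s => ⟪stepFn δ q s, deriv f s⟫) (Icc 0 T) := by
    refine Integrable.mono' (hf'.norm.const_mul M)
      ((stronglyMeasurable_stepFn δ q).aestronglyMeasurable.inner hf'.aestronglyMeasurable)
      (Eventually.of_forall fun s => ?_)
    exact (norm_inner_le_norm _ _).trans (by gcongr; exact hq _)
  have h1 := intervalIntegral.sum_integral_adjacent_intervals_Ico (μ := volume)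
    (f := fun s => ⟪stepFn δ q s, deriv f s⟫) (a := fun i : ℕ => (i : ℝ) * δ) hmn fun i hi => by
      obtain ⟨ha, hb, hc⟩ := hbound i hi
      push_cast
      rw [intervalIntegrable_iff_integrableOn_Icc_of_le hb]
      exact hint.mono_set (Icc_subset_Icc ha hc)
  rw [← h1]
  refine Finset.sum_congr rfl fun i hi => ?_
  obtain ⟨ha, hb, hc⟩ := hbound i (by simpa using hi)
  push_cast
  have hT : 0 ≤ T := ha.trans (hb.trans hc)
  have h2 := (hf.mono (c := i * δ) (d := (i + 1) * δ) (by
    rw [uIcc_of_le hb, uIcc_of_le hT]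
    exact Icc_subset_Icc ha hc)).integral_clm_deriv (innerSL ℝ (q i))
  rw [innerSL_apply_apply] at h2
  rw [← h2]
  refine intervalIntegral.integral_congr_ae ?_
  -- The cells of `stepFn` exclude their right endpoint while interval integrals include it; the
  -- difference is a null set.
  have h3 : ∀ᵐ s, s ≠ ((i : ℝ) + 1) * δ := by simp [ae_iff, measure_singleton]
  filter_upwards [h3] with s hs hs'
  rw [uIoc_of_le hb] at hs'
  rw [stepFn_eq hδ q ⟨hs'.1.le, lt_of_le_of_ne hs'.2 hs⟩, innerSL_apply_apply]

open scoped RealInnerProductSpace in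
lemma IsAdmissible.exists_isTimeDiscretization [FiniteDimensional ℝ E] [FiniteDimensional ℝ F]
    {J ψ : E → ℝ} {A : E →L[ℝ] F} {γ η L C : ℝ} (h : IsAdmissible J ψ A γ η L C)
    {f : ℝ → F} {T : ℝ} (hT : 0 < T) (hf : AbsolutelyContinuousOnInterval f 0 T)
    (hf' : IntegrableOn (deriv f) (Icc 0 T)) {v₀ : E}
    (hv₀ : IsCriticalPoint (fun v => J v + ψ (v - v₀)) A (f 0) v₀) :
    ∃ M : ℝ, ∃ δ₀ > 0, ∀ δ, 0 < δ → δ < δ₀ →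
      ∃ w u q α, IsTimeDiscretization J ψ A f T v₀ η M δ w u q α := by
  have hBV := hf.boundedVariationOn
  rw [uIcc_of_le hT.le] at hBV
  obtain ⟨ρ, hρ, M, hM⟩ := h.exists_discrete hv₀ (eVariationOn f (Icc 0 T)).toReal
  have huc := hf.uniformContinuousOn
  rw [uIcc_of_le hT.le, Metric.uniformContinuousOn_iff] at huc
  obtain ⟨δ₀, hδ₀, huc⟩ := huc ρ hρ
  refine ⟨M, δ₀, hδ₀, fun δ hδ hδδ₀ => ?_⟩
  -- Clamping the nodes at `T` lets the recursion run forever while `f` is used only on `[0, T]`;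
  -- past `T` the datum is constant.
  set τ : ℕ → ℝ := fun i => min (i * δ) T with hτ
  have hτmem : ∀ i, τ i ∈ Icc 0 T := fun i => ⟨le_min (by positivity) hT.le, min_le_right _ _⟩
  have hτmono : Monotone τ := fun i j hij => by
    have : (i : ℝ) ≤ j := by exact_mod_cast hij
    exact min_le_min_right _ (by gcongr)
  have hτ0 : τ 0 = 0 := by simp [hτ, hT.le]
  obtain ⟨V, U, Q, hV0, hstep, hAV, hQ, hUV, hsum⟩ := hM (fun i => f (τ i)) (by simp only [hτ0])
    (fun n => by
      have h1 := eVariationOn.sum_le (f := f) (n := n) hτmono hτmem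
      rw [← ENNReal.ofReal_le_iff_le_toReal hBV, ENNReal.ofReal_sum_of_nonneg
        fun _ _ => norm_nonneg _]
      simpa only [edist_dist, dist_eq_norm] using h1)
    (fun i => by
      have h1 := huc (τ (i + 1)) (hτmem _) (τ i) (hτmem _) (by
        have h2 : |τ (i + 1) - τ i| ≤ max |((i + 1 : ℕ) : ℝ) * δ - i * δ| |T - T| :=
          abs_min_sub_min_le_max _ _ _ _
        have h3 : ((i + 1 : ℕ) : ℝ) * δ - i * δ = δ := by push_cast; ring
        rw [h3, sub_self, abs_zero, abs_of_pos hδ, max_eq_left hδ.le] at h2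
        exact h2.trans_lt hδδ₀)
      rw [dist_eq_norm] at h1
      exact h1.le)
  set q : ℕ → F := fun i => (InnerProductSpace.toDual ℝ F).symm (Q i)
  have hqQ : ∀ i y, ⟪q i, y⟫ = Q i y := fun i y => InnerProductSpace.toDual_symm_apply
  have hqM : ∀ i, ‖q i‖ ≤ M := fun i => by
    simpa only [q, LinearIsometryEquiv.norm_map] using hQ i
  -- The accumulated dissipation becomes the monotone control `α` of Helly's principle.
  set P : ℕ → ℝ := fun n => ∑ i ∈ Finset.range n, ψ (V (i + 1) - V i)
  have hP : Monotone P := fun m n hmn => Finset.sum_le_sum_of_subset_of_nonneg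
    (Finset.range_subset_range.2 hmn) fun _ _ _ => h.diss_nonneg _
  have hP0 : ∀ n, 0 ≤ P n := fun n => Finset.sum_nonneg fun _ _ => h.diss_nonneg _
  have hψP : ∀ m n, m ≤ n → ψ (V n - V m) ≤ P n - P m := fun m n hmn => by
    induction n, hmn using Nat.le_induction with
    | base => simp [h.sublinear.map_zero]
    | succ n hmn ih =>
      have h1 := h.sublinear.add_le (V (n + 1) - V n) (V n - V m)
      rw [sub_add_sub_cancel] at h1
      have h2 : P (n + 1) = P n + ψ (V (n + 1) - V n) := Finset.sum_range_succ _ _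
      linarith
  refine ⟨stepFn δ V, stepFn δ U, stepFn δ q, stepFn δ P, ?_⟩
  exact {
    evolution := by
      refine isDiscreteEvolution_stepFn hδ hV0 hv₀ fun i hi => ?_
      have h1 := (hstep i).critical
      have h2 : τ (i + 1) = (i + 1) * δ := by
        simp only [hτ]; push_cast; exact min_eq_left hi
      rwa [h2] at h1
    stronglyMeasurable := stronglyMeasurable_stepFn _ _
    stronglyMeasurable_aux := stronglyMeasurable_stepFn _ _
    stronglyMeasurable_multiplier := stronglyMeasurable_stepFn _ _
    monotone := fun s t hst => hP (floor_div_mono hδ hst)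
    abs_le := fun t => by
      rw [stepFn, abs_of_nonneg (hP0 _)]
      exact hsum _
    diss_le := fun s t hst => hψP _ _ (floor_div_mono hδ hst)
    zero_eq := by rw [stepFn_of_lt hδ V hδ, hV0]
    multiplier_le := fun t => hqM _
    map_eq := fun t => hAV _
    dist_sq_le := fun t => by
      have h1 := hUV ⌊t / δ⌋₊
      simp only [hτ] at h1
      push_cast at h1
      exact h1
    aux_stable := fun t v => by
      have h1 := (hstep ⌊t / δ⌋₊).aux_stable v
      rw [← hqQ] at h1
      exact h1
    energy := fun t₁ t₂ h1 h12 h2 => by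
      have hn : ⌊t₂ / δ⌋₊ * δ ≤ T := (floor_div_mul_le hδ (h1.trans h12)).trans h2
      rw [← sum_multiplier_eq_integral hf hf' hδ hqM (floor_div_mono hδ h12) hn]
      have hmn := floor_div_mono hδ h12
      simp only [stepFn]
      generalize ⌊t₁ / δ⌋₊ = m at *
      generalize ⌊t₂ / δ⌋₊ = n at *
      have h3 : ∀ k : ℕ, (k : ℝ) * δ ≤ T → τ k = k * δ := fun k hk => min_eq_left hk
      clear h12 h2
      induction n, hmn using Nat.le_induction with
      | base => simp
      | succ n hmn ih =>
        have hn' : (n : ℝ) * δ ≤ T := le_trans (by push_cast; nlinarith) hn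
        have h4 := ih hn'
        have h5 := (hstep n).energy_step h.η_pos.le
        rw [hAV, h3 _ hn, h3 _ hn', ← hqQ] at h5
        rw [Finset.sum_Ico_succ_top hmn]
        have h6 : P (n + 1) = P n + ψ (V (n + 1) - V n) := Finset.sum_range_succ _ _
        push_cast at h5
        linarith }

end TimeDiscretization

/-! ### Passage to a pointwise limit of the states -/

section Approximation

lemma tendsto_floor_div_mul {δ : ℕ → ℝ} (hδ : Tendsto δ atTop (𝓝[>] 0)) {t : ℝ} (ht : 0 ≤ t) :
    Tendsto (fun k => ⌊t / δ k⌋₊ * δ k) atTop (𝓝 t) := by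
  rw [tendsto_nhdsWithin_iff] at hδ
  have h1 : Tendsto (fun k => t - δ k) atTop (𝓝 t) := by simpa using hδ.1.const_sub t
  refine tendsto_of_tendsto_of_tendsto_of_le_of_le' h1 tendsto_const_nhds ?_ ?_
  · filter_upwards [hδ.2] with k hk
    have := lt_floor_div_add_one_mul hk t
    linarith
  · filter_upwards [hδ.2] with k hk
    exact floor_div_mul_le hk ht

lemma tendsto_constraint_grid {X : Type*} [TopologicalSpace X] {f : ℝ → X} {T : ℝ} (hf : ContinuousOn f (Icc 0 T)) {δ : ℕ → ℝ}
    (hδ : Tendsto δ atTop (𝓝[>] 0)) {t : ℝ} (ht : t ∈ Icc 0 T) :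
    Tendsto (fun k => f (min (⌊t / δ k⌋₊ * δ k) T)) atTop (𝓝 (f t)) ∧
      Tendsto (fun k => f (min ((⌊t / δ k⌋₊ + 1) * δ k) T)) atTop (𝓝 (f t)) := by
  have hgrid := tendsto_floor_div_mul hδ ht.1
  rw [tendsto_nhdsWithin_iff] at hδ
  have hmin : ∀ x : ℕ → ℝ, Tendsto x atTop (𝓝 t) → (∀ᶠ k in atTop, 0 ≤ x k) →
      Tendsto (fun k => f (min (x k) T)) atTop (𝓝 (f t)) := fun x hx h0 => by
    refine (hf t ht).tendsto.comp (tendsto_nhdsWithin_iff.2 ⟨?_, ?_⟩)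
    · simpa [min_eq_left ht.2] using hx.min (tendsto_const_nhds (x := T))
    · filter_upwards [h0] with k hk
      exact ⟨le_min hk (ht.1.trans ht.2), min_le_right _ _⟩
  have hpos : ∀ᶠ k in atTop, 0 < δ k := hδ.2
  refine ⟨hmin _ hgrid ?_, hmin _ ?_ ?_⟩
  · filter_upwards [hpos] with k hk
    positivity
  · simpa [add_mul] using hgrid.add hδ.1
  · filter_upwards [hpos] with k hk
    positivity

namespace IsTimeDiscretization

variable {J ψ : E → ℝ} {A : E →L[ℝ] F} {f : ℝ → F} {T η M δ : ℝ} {v₀ : E} {w u : ℝ → E}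
  {q : ℝ → F} {α : ℝ → ℝ}

lemma norm_sub_le_of_diss (h : IsTimeDiscretization J ψ A f T v₀ η M δ w u q α) {c : ℝ}
    (hc : 0 < c) (hψ : ∀ v, c * ‖v‖ ≤ ψ v) {s t : ℝ} (hst : s ≤ t) :
    ‖w t - w s‖ ≤ c⁻¹ * α t - c⁻¹ * α s := by
  rw [← mul_sub, ← div_eq_inv_mul, le_div_iff₀ hc, mul_comm]
  exact (hψ _).trans (h.diss_le s t hst)

lemma norm_le (h : IsTimeDiscretization J ψ A f T v₀ η M δ w u q α) {c : ℝ}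
    (hc : 0 < c) (hψ : ∀ v, c * ‖v‖ ≤ ψ v) (t : ℝ) : ‖w t‖ ≤ ‖v₀‖ + c⁻¹ * (2 * M) := by
  have hα : ∀ s t, c⁻¹ * α t - c⁻¹ * α s ≤ c⁻¹ * (2 * M) := fun s t => by
    rw [← mul_sub]
    have h1 := _root_.abs_le.1 (h.abs_le s)
    have h2 := _root_.abs_le.1 (h.abs_le t)
    exact mul_le_mul_of_nonneg_left (by linarith) (inv_nonneg.2 hc.le)
  have h1 : ‖w t - w 0‖ ≤ c⁻¹ * (2 * M) := by
    rcases le_total 0 t with ht | ht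
    · exact (h.norm_sub_le_of_diss hc hψ ht).trans (hα _ _)
    · rw [norm_sub_rev]
      exact (h.norm_sub_le_of_diss hc hψ ht).trans (hα _ _)
  rw [h.zero_eq] at h1
  have h2 := norm_le_norm_add_norm_sub' (w t) v₀
  linarith

open scoped RealInnerProductSpace in
/-- The discrete energy inequality on `[t₁, t₂]`, with an error from the two incomplete steps. -/
lemma energy_le (h : IsTimeDiscretization J ψ A f T v₀ η M δ w u q α)
    (hf' : IntegrableOn (deriv f) (Icc 0 T)) {t₁ t₂ : ℝ} (h1 : 0 ≤ t₁) (h12 : t₁ ≤ t₂)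
    (h2 : t₂ ≤ T) :
    J (w t₂) + (α t₂ - α t₁) ≤ J (w t₁) + (∫ s in t₁..t₂, ⟪q s, deriv f s⟫) +
      M * ((∫ s in 0..t₁, ‖deriv f s‖) - ∫ s in 0..(⌊t₁ / δ⌋₊ * δ), ‖deriv f s‖) +
      M * ((∫ s in 0..t₂, ‖deriv f s‖) - ∫ s in 0..(⌊t₂ / δ⌋₊ * δ), ‖deriv f s‖) := by
  have hδ := h.evolution.step_pos
  have hsub : ∀ {a b : ℝ}, a ∈ Icc 0 T → b ∈ Icc 0 T → uIcc a b ⊆ Icc 0 T := fun ha hb =>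
    (convex_Icc 0 T).ordConnected.uIcc_subset ha hb
  have hint : ∀ {a b : ℝ}, a ∈ Icc 0 T → b ∈ Icc 0 T →
      IntervalIntegrable (fun s => ⟪q s, deriv f s⟫) volume a b := fun ha hb => by
    have h3 : IntegrableOn (fun s => ⟪q s, deriv f s⟫) (Icc 0 T) := by
      refine Integrable.mono' (hf'.norm.const_mul M)
        (h.stronglyMeasurable_multiplier.aestronglyMeasurable.inner hf'.aestronglyMeasurable)
        (Eventually.of_forall fun s => ?_)
      exact (norm_inner_le_norm _ _).trans (by gcongr; exact h.multiplier_le _)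
    exact (h3.mono_set (hsub ha hb)).intervalIntegrable
  have hint' : ∀ {a b : ℝ}, a ∈ Icc 0 T → b ∈ Icc 0 T →
      IntervalIntegrable (fun s => ‖deriv f s‖) volume a b := fun ha hb =>
    (IntegrableOn.mono_set hf'.norm (hsub ha hb)).intervalIntegrable
  have hT : 0 ≤ T := h1.trans (h12.trans h2)
  have h0 : (0 : ℝ) ∈ Icc 0 T := ⟨le_rfl, hT⟩
  have hm : ∀ {t}, t ∈ Icc 0 T → ⌊t / δ⌋₊ * δ ∈ Icc 0 T := fun ht =>
    ⟨by positivity, (floor_div_mul_le hδ ht.1).trans ht.2⟩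
  have herr : ∀ {t}, t ∈ Icc 0 T → |∫ s in (⌊t / δ⌋₊ * δ)..t, ⟪q s, deriv f s⟫| ≤
      M * ((∫ s in 0..t, ‖deriv f s‖) - ∫ s in 0..(⌊t / δ⌋₊ * δ), ‖deriv f s‖) := fun {t} ht => by
    rw [intervalIntegral.integral_interval_sub_left (hint' h0 ht) (hint' h0 (hm ht)),
      ← intervalIntegral.integral_const_mul, ← Real.norm_eq_abs]
    refine intervalIntegral.norm_integral_le_of_norm_le (floor_div_mul_le hδ ht.1)
      (Eventually.of_forall fun s _ => ?_) ((hint' (hm ht) ht).const_mul M)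
    exact (norm_inner_le_norm _ _).trans (by gcongr; exact h.multiplier_le _)
  have ht₁ : t₁ ∈ Icc 0 T := ⟨h1, h12.trans h2⟩
  have ht₂ : t₂ ∈ Icc 0 T := ⟨h1.trans h12, h2⟩
  have h3 := h.energy t₁ t₂ h1 h12 h2
  have h4 := intervalIntegral.integral_add_adjacent_intervals (hint (hm ht₁) ht₁) (hint ht₁ ht₂)
  have h5 := intervalIntegral.integral_add_adjacent_intervals (hint (hm ht₁) (hm ht₂))
    (hint (hm ht₂) ht₂)
  have h6 := (_root_.abs_le.1 (herr ht₁)).2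
  have h7 := (_root_.abs_le.1 (herr ht₂)).1
  linarith

lemma sum_diss_le (h : IsTimeDiscretization J ψ A f T v₀ η M δ w u q α) {n : ℕ} {t : ℕ → ℝ}
    (ht : ∀ i < n, t i < t (i + 1)) :
    ∑ i ∈ Finset.range n, ψ (w (t (i + 1)) - w (t i)) ≤ α (t n) - α (t 0) := by
  rw [← Finset.sum_range_sub (fun i => α (t i))]
  exact Finset.sum_le_sum fun i hi => h.diss_le _ _ (ht i (Finset.mem_range.1 hi)).le

end IsTimeDiscretization

/-- A converging family of time discretizations. -/
structure IsApproximation (J ψ : E → ℝ) (A : E →L[ℝ] F) (f : ℝ → F) (T : ℝ) (v₀ : E)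
    (η M R : ℝ) (δ : ℕ → ℝ) (w u : ℕ → ℝ → E) (q : ℕ → ℝ → F) (α : ℕ → ℝ → ℝ) (v : ℝ → E) :
    Prop where
  step_tendsto : Tendsto δ atTop (𝓝[>] 0)
  discretization : ∀ k, IsTimeDiscretization J ψ A f T v₀ η M (δ k) (w k) (u k) (q k) (α k)
  norm_le : ∀ k t, ‖w k t‖ ≤ R
  tendsto : ∀ t, Tendsto (fun k => w k t) atTop (𝓝 (v t))

lemma IsAdmissible.exists_isApproximation [FiniteDimensional ℝ E] [FiniteDimensional ℝ F]
    {J ψ : E → ℝ} {A : E →L[ℝ] F} {γ η L C : ℝ} (h : IsAdmissible J ψ A γ η L C)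
    (hψ : ∀ v, v ≠ 0 → 0 < ψ v)
    {f : ℝ → F} {T : ℝ} (hT : 0 < T) (hf : AbsolutelyContinuousOnInterval f 0 T)
    (hf' : IntegrableOn (deriv f) (Icc 0 T)) {v₀ : E}
    (hv₀ : IsCriticalPoint (fun v => J v + ψ (v - v₀)) A (f 0) v₀) :
    ∃ M R δ w u q α v, IsApproximation J ψ A f T v₀ η M R δ w u q α v ∧
      BoundedVariationOn v (Icc 0 T) := by
  obtain ⟨M, δ₀, hδ₀, hdisc⟩ := h.exists_isTimeDiscretization hT hf hf' hv₀
  obtain ⟨c, hc, hcψ⟩ := h.sublinear.exists_mul_norm_le hψ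
  have hpos : ∀ k : ℕ, 0 < δ₀ / 2 * (1 / ((k : ℝ) + 1)) := fun k => by positivity
  have hlt : ∀ k : ℕ, δ₀ / 2 * (1 / ((k : ℝ) + 1)) < δ₀ := fun k => by
    have h1 : 1 / ((k : ℝ) + 1) ≤ 1 := (div_le_one (by positivity)).2 (by
      have : (0 : ℝ) ≤ k := k.cast_nonneg
      linarith)
    nlinarith
  choose w u q α hd using fun k : ℕ => hdisc _ (hpos k) (hlt k)
  obtain ⟨φ, v, a, hφ, ha, hva, hlim⟩ := exists_subseq_tendsto_of_monotone_control (w := w)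
    -- Dividing by the coercivity constant of `ψ` turns control of the dissipation into control of
    -- the norm.
    (α := fun k t => c⁻¹ * α k t) (M := c⁻¹ * M) (R := ‖v₀‖ + c⁻¹ * (2 * M))
    (fun k => (hd k).monotone.const_mul (inv_nonneg.2 hc.le))
    (fun k t => by
      rw [abs_mul, abs_of_pos (inv_pos.2 hc)]
      exact mul_le_mul_of_nonneg_left ((hd k).abs_le t) (inv_nonneg.2 hc.le))
    (fun k s t hst => (hd k).norm_sub_le_of_diss hc hcψ hst)
    (fun k t => (hd k).norm_le hc hcψ t)
  refine ⟨M, ‖v₀‖ + c⁻¹ * (2 * M), fun k => δ₀ / 2 * (1 / ((φ k : ℝ) + 1)), fun k => w (φ k),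
    fun k => u (φ k), fun k => q (φ k), fun k => α (φ k), v,
    ⟨?_, fun k => hd (φ k), fun k t => (hd (φ k)).norm_le hc hcψ t, hlim⟩,
    boundedVariationOn_of_monotone_control ha hva 0 T⟩
  refine tendsto_nhdsWithin_iff.2 ⟨?_, Eventually.of_forall fun k => hpos (φ k)⟩
  have := (tendsto_one_div_add_atTop_nhds_zero_nat (𝕜 := ℝ)).const_mul (δ₀ / 2)
  rw [mul_zero] at this
  exact this.comp hφ.tendsto_atTop

namespace IsApproximation

variable {J ψ : E → ℝ} {A : E →L[ℝ] F} {f : ℝ → F} {T η M R : ℝ} {v₀ : E} {δ : ℕ → ℝ}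
  {w u : ℕ → ℝ → E} {q : ℕ → ℝ → F} {α : ℕ → ℝ → ℝ} {v : ℝ → E}

lemma norm_limit_le (h : IsApproximation J ψ A f T v₀ η M R δ w u q α v) (t : ℝ) : ‖v t‖ ≤ R :=
  le_of_tendsto' (h.tendsto t).norm fun k => h.norm_le k t

lemma stronglyMeasurable (h : IsApproximation J ψ A f T v₀ η M R δ w u q α v) :
    StronglyMeasurable v :=
  stronglyMeasurable_of_tendsto atTop (fun k => (h.discretization k).stronglyMeasurable)
    (tendsto_pi_nhds.2 h.tendsto)

lemma isApproximableEvolution [MeasurableSpace E] [BorelSpace E]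
    (h : IsApproximation J ψ A f T v₀ η M R δ w u q α v) :
    IsApproximableEvolution J ψ A f T v₀ v := by
  refine ⟨?_, h.stronglyMeasurable.measurable.comp measurable_subtype_coe, δ, w, h.step_tendsto,
    fun k => (h.discretization k).evolution, fun t _ => ?_⟩
  · refine isBounded_iff_forall_norm_le.2 ⟨R, ?_⟩
    rintro _ ⟨t, -, rfl⟩
    exact h.norm_limit_le t
  · refine Tendsto.liminf_eq ?_
    have h1 : Tendsto (fun k => w k t - v t) atTop (𝓝 0) := by
      simpa using (h.tendsto t).sub_const (v t)
    simpa using h1.enorm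

lemma map_limit (h : IsApproximation J ψ A f T v₀ η M R δ w u q α v)
    (hf : ContinuousOn f (Icc 0 T)) {t : ℝ} (ht : t ∈ Icc 0 T) : A (v t) = f t := by
  refine tendsto_nhds_unique ((A.continuous.tendsto _).comp (h.tendsto t)) ?_
  exact (tendsto_constraint_grid hf h.step_tendsto ht).1.congr fun k =>
    ((h.discretization k).map_eq t).symm

/-- The gap `‖u - w‖²` is at most `M` times the increment of `f` over one cell, which vanishes by
continuity. -/
lemma tendsto_aux (h : IsApproximation J ψ A f T v₀ η M R δ w u q α v)
    (hf : ContinuousOn f (Icc 0 T)) {t : ℝ} (ht : t ∈ Icc 0 T) :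
    Tendsto (fun k => u k t) atTop (𝓝 (v t)) := by
  obtain ⟨h1, h2⟩ := tendsto_constraint_grid hf h.step_tendsto ht
  have h3 : Tendsto (fun k => ‖u k t - w k t‖ ^ 2) atTop (𝓝 0) := by
    refine squeeze_zero (fun _ => by positivity) (fun k => (h.discretization k).dist_sq_le t) ?_
    simpa using (h2.sub h1).norm.const_mul M
  have h4 : Tendsto (fun k => ‖u k t - w k t‖) atTop (𝓝 0) := by
    have := (Real.continuous_sqrt.tendsto _).comp h3
    simpa [Function.comp_def, Real.sqrt_sq (norm_nonneg _)] using this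
  simpa using (tendsto_zero_iff_norm_tendsto_zero.2 h4).add (h.tendsto t)

lemma exists_norm_aux_le (h : IsApproximation J ψ A f T v₀ η M R δ w u q α v) (hT : 0 ≤ T)
    (hf : ContinuousOn f (Icc 0 T)) : ∃ R', ∀ k t, ‖u k t‖ ≤ R' := by
  obtain ⟨B, hB⟩ := isCompact_Icc.exists_bound_of_continuousOn hf
  refine ⟨M * (B + B) + 1 + R, fun k t => ?_⟩
  have hd := h.discretization k
  have hδ := hd.evolution.step_pos
  have hM : 0 ≤ M := (norm_nonneg _).trans (hd.multiplier_le 0)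
  have h1 : ‖u k t - w k t‖ ^ 2 ≤ M * (B + B) := (hd.dist_sq_le t).trans (by
    refine mul_le_mul_of_nonneg_left ((norm_sub_le _ _).trans (add_le_add (hB _ ?_) (hB _ ?_))) hM
    exacts [⟨le_min (by positivity) hT, min_le_right _ _⟩,
      ⟨le_min (by positivity) hT, min_le_right _ _⟩])
  have h2 : ‖u k t - w k t‖ ≤ M * (B + B) + 1 := by nlinarith [sq_nonneg (‖u k t - w k t‖ - 1)]
  have h3 := norm_le_norm_add_norm_sub' (u k t) (w k t)
  have h4 := h.norm_le k t
  linarith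

end IsApproximation

end Approximation

/-! ### Stability and energy inequality in the limit -/

section Limit

variable {J ψ : E → ℝ} {A : E →L[ℝ] F} {f : ℝ → F} {T η M R : ℝ} {v₀ : E} {δ : ℕ → ℝ}
  {w u : ℕ → ℝ → E} {q : ℕ → ℝ → F} {α : ℕ → ℝ → ℝ} {v : ℝ → E}

namespace IsApproximation

open scoped RealInnerProductSpace

lemma memLp_multiplier (h : IsApproximation J ψ A f T v₀ η M R δ w u q α v) (k : ℕ) :
    MemLp (q k) 2 (volume.restrict (Icc 0 T)) :=
  MemLp.of_bound (h.discretization k).stronglyMeasurable_multiplier.aestronglyMeasurable M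
    (Eventually.of_forall (h.discretization k).multiplier_le)

/-- The stability inequality in the limit, against a fixed competitor. -/
lemma ae_stable_at [FiniteDimensional ℝ E]
    (h : IsApproximation J ψ A f T v₀ η M R δ w u q α v) (hT : 0 ≤ T)
    (hf : ContinuousOn f (Icc 0 T)) (hJ : Continuous J) (hψ : Continuous ψ)
    {U : Ultrafilter ℕ} (hU : (U : Filter ℕ) ≤ atTop) {r : ℝ → F}
    (hr : MemLp r 2 (volume.restrict (Icc 0 T)))
    (hlim : ∀ φ : ℝ → F, MemLp φ 2 (volume.restrict (Icc 0 T)) →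
      Tendsto (fun k => ∫ s, ⟪q k s, φ s⟫ ∂volume.restrict (Icc 0 T)) U
        (𝓝 (∫ s, ⟪r s, φ s⟫ ∂volume.restrict (Icc 0 T)))) (x : E) :
    ∀ᵐ t ∂volume.restrict (Icc 0 T), J (v t) + ⟪r t, A (x - v t)⟫ - (η + 1) * ‖x - v t‖ ^ 2 ≤
      J x + ψ (x - v t) := by
  obtain ⟨R', hR'⟩ := h.exists_norm_aux_le hT hf
  obtain ⟨B, hB⟩ := isCompact_Icc.exists_bound_of_continuousOn hf
  -- The multiplier is paired with `A (x - u k t)`, which varies with `k`. Replacing it by `A x - f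
  -- t` gives a fixed test function, at the cost of `M ‖f t - A (u k t)‖ → 0`; `G` collects the
  -- strongly convergent terms.
  set G : E × E → ℝ := fun p => J x + ψ (x - p.1) + (η + 1) * ‖x - p.1‖ ^ 2 +
    2 * (η + 1) * ⟪p.1 - p.2, x - p.1⟫ - J p.1 with hG
  have hGc : Continuous G := by fun_prop
  obtain ⟨C, hC⟩ := ((isCompact_closedBall (0 : E) R').prod
    (isCompact_closedBall (0 : E) R)).exists_bound_of_continuousOn hGc.continuousOn
  have hM : 0 ≤ M := (norm_nonneg _).trans ((h.discretization 0).multiplier_le 0)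
  have hmem : ∀ᵐ t ∂volume.restrict (Icc 0 T), t ∈ Icc 0 T := ae_restrict_mem measurableSet_Icc
  have hfm : AEStronglyMeasurable f (volume.restrict (Icc 0 T)) :=
    hf.aestronglyMeasurable measurableSet_Icc
  have key := inner_weak_limit_le (R := fun k t => G (u k t, w k t) + M * ‖f t - A (u k t)‖)
    (R' := fun t => G (v t, v t)) (φ := fun t => A x - f t)
    (C := C + M * (B + ‖A‖ * R')) hU h.memLp_multiplier hr hlim
    (MemLp.of_bound (aestronglyMeasurable_const.sub hfm) (‖A x‖ + B) (by
      filter_upwards [hmem] with t ht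
      exact (norm_sub_le _ _).trans (by gcongr; exact hB t ht)))
    (fun k => by
      have h1 := (h.discretization k).stronglyMeasurable_aux
      have h2 := (h.discretization k).stronglyMeasurable
      exact (hGc.comp_stronglyMeasurable (h1.prodMk h2)).aestronglyMeasurable.add
        ((hfm.sub (A.continuous.comp_stronglyMeasurable h1).aestronglyMeasurable).norm.const_mul M))
    (fun k => by
      filter_upwards [hmem] with t ht
      refine (norm_add_le _ _).trans (add_le_add (hC _ ⟨?_, ?_⟩) ?_)
      · simpa using hR' k t
      · simpa using h.norm_le k t
      · rw [norm_mul, norm_norm, Real.norm_of_nonneg hM]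
        refine mul_le_mul_of_nonneg_left ((norm_sub_le _ _).trans (add_le_add (hB t ht) ?_)) hM
        exact (A.le_opNorm _).trans (by gcongr; exact hR' k t))
    (by
      filter_upwards [hmem] with t ht
      have h1 := h.tendsto_aux hf ht
      have h2 := (hGc.tendsto (v t, v t)).comp (h1.prodMk_nhds (h.tendsto t))
      have h3 := (((A.continuous.tendsto _).comp h1).const_sub (f t)).norm.const_mul M
      simpa [h.map_limit hf ht] using h2.add h3)
    (fun k => Eventually.of_forall fun t => by
      have h1 := (h.discretization k).aux_stable t x
      have h2 : ⟪q k t, A x - f t⟫ = ⟪q k t, A (x - u k t)⟫ - ⟪q k t, f t - A (u k t)⟫ := by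
        rw [← inner_sub_right, map_sub]; congr 1; abel
      have h3 : -⟪q k t, f t - A (u k t)⟫ ≤ M * ‖f t - A (u k t)‖ :=
        (neg_le_abs _).trans ((abs_real_inner_le_norm _ _).trans
          (by gcongr; exact (h.discretization k).multiplier_le t))
      simp only [hG]
      linarith)
  filter_upwards [key, hmem] with t h1 ht
  rw [map_sub, h.map_limit hf ht]
  simp only [hG, sub_self, inner_zero_left, mul_zero, add_zero] at h1
  linarith

/-- The weak limit of the multipliers is, almost everywhere, a stable multiplier. -/
lemma ae_isStableMultiplier [FiniteDimensional ℝ E] [CompleteSpace F]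
    (h : IsApproximation J ψ A f T v₀ η M R δ w u q α v) (hT : 0 ≤ T)
    (hf : ContinuousOn f (Icc 0 T)) (hJ : Continuous J) (hψ : Continuous ψ)
    {U : Ultrafilter ℕ} (hU : (U : Filter ℕ) ≤ atTop) {r : ℝ → F}
    (hr : MemLp r 2 (volume.restrict (Icc 0 T)))
    (hlim : ∀ φ : ℝ → F, MemLp φ 2 (volume.restrict (Icc 0 T)) →
      Tendsto (fun k => ∫ s, ⟪q k s, φ s⟫ ∂volume.restrict (Icc 0 T)) U
        (𝓝 (∫ s, ⟪r s, φ s⟫ ∂volume.restrict (Icc 0 T)))) :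
    ∀ᵐ t ∂volume.restrict (Icc 0 T),
      IsStableMultiplier J ψ A (η + 1) (v t) (InnerProductSpace.toDual ℝ F (r t)) := by
  -- The exceptional null set depends on the competitor, so a countable dense set is used first and
  -- continuity does the rest.
  have h1 := ae_all_iff.2 fun n : ℕ =>
    h.ae_stable_at hT hf hJ hψ hU hr hlim (TopologicalSpace.denseSeq E n)
  filter_upwards [h1] with t ht
  intro x
  rw [InnerProductSpace.toDual_apply_apply]
  have hcl : IsClosed {x | J (v t) + ⟪r t, A (x - v t)⟫ - (η + 1) * ‖x - v t‖ ^ 2 ≤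
      J x + ψ (x - v t)} := isClosed_le (by fun_prop) (by fun_prop)
  have hsub : range (TopologicalSpace.denseSeq E) ⊆ {x | J (v t) + ⟪r t, A (x - v t)⟫ -
      (η + 1) * ‖x - v t‖ ^ 2 ≤ J x + ψ (x - v t)} := by
    rintro _ ⟨n, rfl⟩
    exact ht n
  exact (hcl.closure_subset_iff.2 hsub) (TopologicalSpace.denseRange_denseSeq E x)

/-- The energy inequality in the limit, for a fixed partition. -/
lemma energy_add_sum_le
    (h : IsApproximation J ψ A f T v₀ η M R δ w u q α v)
    (hf' : MemLp (deriv f) 2 (volume.restrict (Icc 0 T))) (hJ : Continuous J) (hψ : Continuous ψ)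
    {U : Ultrafilter ℕ} (hU : (U : Filter ℕ) ≤ atTop) {r : ℝ → F}
    (hlim : ∀ φ : ℝ → F, MemLp φ 2 (volume.restrict (Icc 0 T)) →
      Tendsto (fun k => ∫ s, ⟪q k s, φ s⟫ ∂volume.restrict (Icc 0 T)) U
        (𝓝 (∫ s, ⟪r s, φ s⟫ ∂volume.restrict (Icc 0 T))))
    {n : ℕ} {t : ℕ → ℝ} (h0 : 0 ≤ t 0) (hle : t 0 ≤ t n) (hT : t n ≤ T)
    (ht : ∀ i < n, t i < t (i + 1)) :
    J (v (t n)) + ∑ i ∈ Finset.range n, ψ (v (t (i + 1)) - v (t i)) ≤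
      J (v (t 0)) + ∫ s in (t 0)..(t n), ⟪r s, deriv f s⟫ := by
  have hf1 : IntegrableOn (deriv f) (Icc 0 T) := hf'.integrable (by norm_num)
  have hint : ∀ p : ℝ → F, ∫ s, ⟪p s, (Ioc (t 0) (t n)).indicator (deriv f) s⟫
      ∂volume.restrict (Icc 0 T) = ∫ s in (t 0)..(t n), ⟪p s, deriv f s⟫ := fun p => by
    have h1 : ∀ s, ⟪p s, (Ioc (t 0) (t n)).indicator (deriv f) s⟫ =
        (Ioc (t 0) (t n)).indicator (fun s => ⟪p s, deriv f s⟫) s := fun s => by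
      by_cases hs : s ∈ Ioc (t 0) (t n) <;> simp [hs]
    simp only [h1]
    rw [integral_indicator measurableSet_Ioc, Measure.restrict_restrict measurableSet_Ioc,
      inter_eq_left.2 (Ioc_subset_Icc_self.trans (Icc_subset_Icc h0 hT)),
      intervalIntegral.integral_of_le hle]
  -- Here `deriv f ∈ L²` is needed: it is the test function for the power of the multipliers.
  have hweak := hlim _ (hf'.indicator (measurableSet_Ioc (a := t 0) (b := t n)))
  simp only [hint] at hweak
  have hΦ : ContinuousOn (fun x => ∫ s in 0..x, ‖deriv f s‖) (Icc 0 T) := by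
    have h1 := intervalIntegral.continuousOn_primitive_interval (a := 0) (b := T)
      (μ := volume) (f := fun s => ‖deriv f s‖) (by
        rw [uIcc_of_le (h0.trans (hle.trans hT))]; exact hf1.norm)
    rwa [uIcc_of_le (h0.trans (hle.trans hT))] at h1
  have herr : ∀ x ∈ Icc 0 T, Tendsto (fun k => M * ((∫ s in 0..x, ‖deriv f s‖) -
      ∫ s in 0..(⌊x / δ k⌋₊ * δ k), ‖deriv f s‖)) atTop (𝓝 0) := fun x hx => by
    have h1 := (hΦ x hx).tendsto.comp (tendsto_nhdsWithin_iff.2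
      ⟨tendsto_floor_div_mul h.step_tendsto hx.1, Eventually.of_forall fun k =>
        have hδ := (h.discretization k).evolution.step_pos
        ⟨by positivity, (floor_div_mul_le hδ hx.1).trans hx.2⟩⟩)
    simpa using (h1.const_sub (∫ s in 0..x, ‖deriv f s‖)).const_mul M
  have hL : Tendsto (fun k => J (w k (t n)) +
      ∑ i ∈ Finset.range n, ψ (w k (t (i + 1)) - w k (t i))) U
      (𝓝 (J (v (t n)) + ∑ i ∈ Finset.range n, ψ (v (t (i + 1)) - v (t i)))) := by
    refine (((hJ.tendsto _).comp (h.tendsto _)).add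
      (tendsto_finsetSum _ fun i _ => ?_)).mono_left hU
    exact (hψ.tendsto _).comp ((h.tendsto _).sub (h.tendsto _))
  have hR := (((((hJ.tendsto _).comp (h.tendsto (t 0))).mono_left hU).add hweak).add
    ((herr (t 0) ⟨h0, hle.trans hT⟩).mono_left hU)).add
    ((herr (t n) ⟨h0.trans hle, hT⟩).mono_left hU)
  rw [add_zero, add_zero] at hR
  refine le_of_tendsto_of_tendsto' hL hR fun k => ?_
  have h1 := (h.discretization k).energy_le hf1 h0 hle hT
  have h2 := (h.discretization k).sum_diss_le ht
  simp only [Function.comp_apply]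
  linarith

end IsApproximation

/-- The multipliers of stable states are bounded in terms of the energy. -/
lemma IsAdmissible.norm_le_of_isStableMultiplier [FiniteDimensional ℝ E] {γ L C : ℝ}
    (h : IsAdmissible J ψ A γ η L C) {c : ℝ} {x : E} {p : StrongDual ℝ F}
    (hp : IsStableMultiplier J ψ A c x p) : ‖p‖ ≤ (L * (J x + 1) + C) / γ := by
  obtain ⟨ξ, hξ, ζ, hζ, hsum⟩ := Set.mem_add.1 (h.adj_mem_of_forall hp)
  rw [le_div_iff₀ h.γ_pos, mul_comm]
  calc γ * ‖p‖ ≤ ‖ξ + ζ‖ := hsum ▸ h.adj_bound p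
    _ ≤ ‖ξ‖ + ‖ζ‖ := norm_add_le _ _
    _ ≤ _ := add_le_add (h.subdiff_bound _ _ hξ) (h.norm_le_of_mem_Kstar hζ)

end Limit

end RateIndep


/-! ### Assembly of the theorem -/

open RateIndep

theorem theorem2p8 {E F : Type*}
    [NormedAddCommGroup E] [InnerProductSpace ℝ E] [FiniteDimensional ℝ E]
    [MeasurableSpace E] [BorelSpace E]
    [NormedAddCommGroup F] [InnerProductSpace ℝ F] [FiniteDimensional ℝ F]
    (hdim : Module.finrank ℝ F < Module.finrank ℝ E)
    (J ψ : E → ℝ) (A : E →L[ℝ] F) (T : ℝ) (f : ℝ → F) (v₀ : E)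
    (hT : 0 < T)
    (hJ_nonneg : ∀ v, 0 ≤ J v) (hψ_nonneg : ∀ v, 0 ≤ ψ v)
    (hγ : ∃ γ : ℝ, 0 < γ ∧ ∀ q : StrongDual ℝ F, γ * ‖q‖ ≤ ‖adj A q‖)
    (hJ1 : Tendsto (fun v => J v + ‖A v‖ ^ 2) (Bornology.cobounded E) atTop)
    (hJ2 : ∃ η : ℝ, 0 < η ∧ StronglyConvex (fun v => J v + η * ‖v‖ ^ 2))
    (hJ3 : ∃ L : ℝ, 0 < L ∧ ∀ v, ∀ ξ ∈ frechetSubdiff J v, ‖ξ‖ ≤ L * (J v + 1))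
    (hψ1 : ∀ v, ψ v = 0 ↔ v = 0)
    (hψ2 : ∀ v₁ v₂, ψ (v₁ + v₂) ≤ ψ v₁ + ψ v₂)
    (hψ3 : ∀ c : ℝ, 0 ≤ c → ∀ v, ψ (c • v) = c * ψ v)
    (hf : MemW12 f T)
    (hv₀ : IsCriticalPoint (fun v => J v + ψ (v - v₀)) A (f 0) v₀) :
    ∃ (v : ℝ → E) (q : ℝ → StrongDual ℝ F),
      BoundedVariationOn v (Icc 0 T) ∧
      MemLp q ∞ (volume.restrict (Icc 0 T)) ∧
      IsApproximableEvolution J ψ A f T v₀ v ∧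
      (∀ᵐ t ∂(volume.restrict (Icc 0 T)), adj A (q t) ∈ frechetSubdiff J (v t) + Kstar ψ) ∧
      IntegrableOn (fun s => q s (deriv f s)) (Ioo 0 T) ∧
      ∀ t₁ t₂ : ℝ, 0 ≤ t₁ → t₁ < t₂ → t₂ ≤ T →
        (J (v t₂) : EReal) + psiVar ψ v t₁ t₂ ≤
          ((J (v t₁) + ∫ s in t₁..t₂, q s (deriv f s) : ℝ) : EReal) := by
  obtain ⟨γ, hγ0, hγ⟩ := hγ
  obtain ⟨η, hη, hJ2⟩ := hJ2
  obtain ⟨L, hL, hJ3⟩ := hJ3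
  have hψ : IsSublinear ψ := ⟨hψ2, hψ3⟩
  obtain ⟨C, hC, hψC⟩ := hψ.exists_le_mul_norm
  have hadm : IsAdmissible J ψ A γ η L C := ⟨hJ_nonneg, hψ_nonneg, hγ0, hγ, hJ1, hη,
    semiconvexWith_of_stronglyConvex hη hJ_nonneg hψ.continuous hJ2 hv₀.1, hL, hJ3, hψ, hC, hψC⟩
  have hJc := hadm.semiconvex.continuous
  have hψpos : ∀ v, v ≠ 0 → 0 < ψ v := fun v hv =>
    lt_of_le_of_ne (hψ_nonneg v) fun h => hv ((hψ1 v).1 h.symm)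
  have hfc : ContinuousOn f (Icc 0 T) := by
    simpa [uIcc_of_le hT.le] using hf.1.continuousOn
  obtain ⟨M, R, δ, w, u, q, α, v, happ, hBV⟩ := hadm.exists_isApproximation hψpos hT hf.1
    (hf.2.integrable (by norm_num)) hv₀
  have : CompleteSpace F := FiniteDimensional.complete ℝ F
  have hU : ((hyperfilter ℕ : Ultrafilter ℕ) : Filter ℕ) ≤ atTop := by
    rw [← Nat.cofinite_eq_atTop]; exact hyperfilter_le_cofinite
  obtain ⟨r, hr, hlim⟩ := exists_weak_limit (μ := volume.restrict (Icc 0 T)) (q := q)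
    (fun k => (happ.discretization k).stronglyMeasurable_multiplier.aestronglyMeasurable)
    (fun k => (happ.discretization k).multiplier_le) (hyperfilter ℕ)
  have hstab := happ.ae_isStableMultiplier hT.le hfc hJc hψ.continuous hU hr hlim
  refine ⟨v, fun t => InnerProductSpace.toDual ℝ F (r t), hBV, ?_, happ.isApproximableEvolution,
    ?_, ?_, fun t₁ t₂ h1 h12 h2 => ?_⟩
  -- The `L^∞` bound is read off from stability almost everywhere and the boundedness of `J` along
  -- `v`.
  · obtain ⟨B, hB⟩ := (isCompact_closedBall (0 : E) R).exists_bound_of_continuousOn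
      hJc.continuousOn
    refine memLp_top_of_bound ((InnerProductSpace.toDual ℝ F).continuous.comp_aestronglyMeasurable
      hr.aestronglyMeasurable) ((L * (B + 1) + C) / γ) ?_
    filter_upwards [hstab] with t ht
    refine (hadm.norm_le_of_isStableMultiplier ht).trans ?_
    have := (le_abs_self _).trans (hB (v t) (by simpa using happ.norm_limit_le t))
    gcongr
  · filter_upwards [hstab] with t ht
    exact hadm.adj_mem_of_forall ht
  · simp only [InnerProductSpace.toDual_apply_apply]
    exact IntegrableOn.mono_set (hr.integrable_inner_two hf.2) Ioo_subset_Icc_self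
  · simp only [InnerProductSpace.toDual_apply_apply]
    -- The energy `J (v t₂)` is moved to the right first, so that the supremum over partitions is
    -- bounded by a real number.
    have h3 : psiVar ψ v t₁ t₂ ≤ ((J (v t₁) + ∫ s in t₁..t₂, inner ℝ (r s) (deriv f s)) -
        J (v t₂) : ℝ) := by
      refine iSup_le fun n => iSup_le fun t => iSup_le fun ht => ?_
      obtain ⟨rfl, rfl, ht⟩ := ht
      have h4 := happ.energy_add_sum_le hf.2 hJc hψ.continuous hU hlim h1 h12.le h2 ht
      exact EReal.coe_le_coe_iff.2 (by linarith)
    refine (add_le_add le_rfl h3).trans (le_of_eq ?_)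
    rw [← EReal.coe_add]
    congr 1
    ring
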